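/- **Model.** Role terms are built from identifiers, role names, function terms $f(x_1,\dots,x_n)$ (long-term keys; their arguments contain no identifiers), pairs $(x,y)$ and encryptions $\{x\}_y$. Subterms are taken through pairs and encryptions only. Run terms are built in the same way from agent names, and from nonce run terms: constants $c\sharp rid$ marked with a run identifier, and terms from an infinite set $IT$ of intruder-generated terms. A role specification is a list of labelled events (create, send, read, claim, end; one create event first, one end event last) together with a typing of the identifiers that appear in it as constants, variables or parameters. A protocol is a partial map from role names to role specifications; labels within a protocol are unique, except that corresponding send and read events share their label. Secret long-term keys occur in messages only as keys, never as content. In a protocol set no label is used by two protocols. An instantiation $inst=(rid,\rho,\sigma)$ assigns agents to roles ($\rho$) and nonce run terms to variables and parameters ($\sigma$), and sends a constant $c$ to $c\sharp rid$. A run starts with $\sigma$ defined exactly on the parameters, with arbitrary values. $Tr(\Pi)$ is the set of valid traces, i.e. finite sequences of pairs $(inst,ev)$, of the system in which runs of roles of protocols of $\Pi$ communicate through a Dolev–Yao intruder, whose knowledge is closed under pairing, projection, encryption, and decryption with known inverse keys. The initial intruder knowledge does not depend on the protocol set: it is the closure of the agent names, $IT$, the public keys and a set of compromised long-term keys. A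 trace restriction is a predicate $\chi$ on traces. **Independence.** Disjoint $\Pi_1,\Pi_2$ are *independent in the context of $\chi$* if in every trace in $Tr(\Pi_1\cup\Pi_2)$ satisfying $\chi$, whenever $\{x\}_y$ is a subterm of the message of a send event $(inst,ev)$ with label $\ell$, $\{x'\}_{y'}$ is a subterm of the term of a send, read or claim event $(inst',ev')$ with label $\ell'$, and $inst(\{x\}_y)=inst'(\{x'\}_{y'})$, then $\ell,\ell'$ both belong to $\Pi_1$ or both belong to $\Pi_2$. If $\chi$ is always true, they are called *independent*. **Security properties.** A security property $f_{cl}$ assigns to a protocol set $\Pi$ and a claim event $ev$ with claim $cl$ a predicate $f_{cl}(\Pi,ev)(inst,\alpha)$ on instantiations and traces $\alpha\in Tr(\Pi)$. $\Pi$ *satisfies* $\ell$ (*under $\chi$*) if for every $\alpha\in Tr(\Pi)$ (satisfying $\chi$) and every event $(inst,ev)$ of $\alpha$, where $ev$ is a claim event with label $\ell$ and claim $cl$, either $f_{cl}(\Pi,ev)(inst,\alpha)$ holds or some role is assigned an untrusted agent by $inst$. Let $\pi_P(\alpha)$ be $\alpha$ with all events not belonging to $P$ removed. For a bijection $s$ of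 the nonce run terms, $s\circ inst$ is obtained by applying $s$ to the values of $\sigma$, provided that $s$ fixes $c\sharp rid$ for the constants $c$ of the role specification concerned; $s(\alpha)$ is obtained by replacing every $inst$ in $\alpha$ by $s\circ inst$. $f_{cl}$ is *protocol-centric* if for all protocol sets $\Pi,\Pi'$, every $P\in\Pi\cap\Pi'$, every claim event $ev$ of $P$ with claim $cl$, every $s$, every $inst$ (with $s\circ inst$ defined in the context of $ev$), and all $\alpha\in Tr(\Pi)$, $\alpha'\in Tr(\Pi')$ with $s(\pi_P(\alpha))=\pi_P(\alpha')$, $f_{cl}(\Pi,ev)(inst,\alpha)$ holds if and only if $f_{cl}(\Pi',ev)(s\circ inst,\alpha')$ holds. **Theorem.** Let $\Pi_1\cup\Pi_2$ be a protocol set, and let $\chi$ be a (possibly trivial) trace restriction such that no secret input passes from $\Pi_1$ to $\Pi_2$: in every $\alpha\in Tr(\Pi_1\cup\Pi_2)$ satisfying $\chi$, if the initial value of a parameter of a $\Pi_2$-run is $c\sharp rid$, where $rid$ is a $\Pi_1$-run in $\alpha$ and $c$ a constant of its role, then the intruder knows $c\sharp rid$ when that $\Pi_2$-run is created. (This holds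 automatically, for every $\chi$, if the protocols in $\Pi_2$ have no parameters.) Suppose that $\Pi_1$ and $\Pi_2$ are independent in the context of $\chi$. Let $\ell$ be the label of a claim event in $\Pi_1$ whose security property is protocol-centric. If $\Pi_1$ satisfies $\ell$, then $\Pi_1\cup\Pi_2$ satisfies $\ell$ under $\chi$. In particular, if $\chi$ is always true and $\Pi_1,\Pi_2$ are independent, then $\Pi_1\cup\Pi_2$ satisfies $\ell$. -/

import Mathlib

universe u

namespace SecProt

/-- The basic sets of the model and the context in which the intruder operates.
`inv` pairs a key function with the function that constructs the inverse key (`pk` with `sk`;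
a function for symmetric keys is its own inverse). `isPublic` singles out the functions that
construct public keys, `trusted` the trusted agents (all others are untrusted), and `compromised`
the further long-term keys that the intruder holds initially, for instance those of the untrusted
agents. -/
structure Signature where
  Id : Type u
  Role : Type u
  Fn : Type u
  Label : Type u
  Claim : Type u
  RunId : Type u
  /-- intruder-generated terms -/
  IT : Type u
  Agent : Type u
  inv : Fn → Fn
  inv_inv : ∀ f, inv (inv f) = f
  isPublic : Set Fn
  trusted : Set Agent
  compromised : ∀ (_ : Fn) (n : ℕ), Set (Fin n → Agent)

/-- Role terms: templates of messages. `enc x y` is the encryption of `x` with `y`. -/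
inductive RoleTerm (M : Signature.{u}) : Type u
  | ident (c : M.Id)
  | role (r : M.Role)
  | fn (f : M.Fn) (n : ℕ) (args : Fin n → RoleTerm M)
  | pair (x y : RoleTerm M)
  | enc (x y : RoleTerm M)

/-- Nonce run terms: constants made unique by a run identifier, and intruder-generated terms. -/
inductive Nonce (M : Signature.{u}) : Type u
  | fresh (c : M.Id) (rid : M.RunId)
  | intruder (a : M.IT)

/-- Run terms: the actual messages. -/
inductive RunTerm (M : Signature.{u}) : Type u
  | agent (a : M.Agent)
  | fn (f : M.Fn) (n : ℕ) (args : Fin n → RunTerm M)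
  | nonce (n : Nonce M)
  | pair (t v : RunTerm M)
  | enc (t v : RunTerm M)

variable {M : Signature.{u}}

/-- The identifiers that occur in a role term. -/
def RoleTerm.idents : RoleTerm M → Set M.Id
  | .ident c => {c}
  | .role _ => ∅
  | .fn _ _ args => ⋃ i, (args i).idents
  | .pair x y => x.idents ∪ y.idents
  | .enc x y => x.idents ∪ y.idents

/-- The subterm relation on role terms; it does not look into the arguments of functions. -/
inductive RoleTerm.Subterm : RoleTerm M → RoleTerm M → Prop
  | refl (x) : Subterm x x
  | pair_left {x y z} : Subterm x y → Subterm x (.pair y z)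
  | pair_right {x y z} : Subterm x z → Subterm x (.pair y z)
  | enc_left {x y z} : Subterm x y → Subterm x (.enc y z)
  | enc_right {x y z} : Subterm x z → Subterm x (.enc y z)

/-- Functions only construct long-term keys, such as `pk(r)` or `k(r, r')`: what they are applied
to does not depend on the identifiers, that is, on data of a single run. -/
def RoleTerm.FnLongTerm : RoleTerm M → Prop
  | .ident _ => True
  | .role _ => True
  | .fn _ _ args => ∀ i, (args i).idents = ∅
  | .pair x y => x.FnLongTerm ∧ y.FnLongTerm
  | .enc x y => x.FnLongTerm ∧ y.FnLongTerm

/-- Secret long-term keys are used only as keys (in the second component of an encryption), never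
as content. -/
def RoleTerm.SecretKeysOnlyAsKeys : RoleTerm M → Prop
  | .ident _ => True
  | .role _ => True
  | .fn f _ _ => f ∈ M.isPublic
  | .pair x y => x.SecretKeysOnlyAsKeys ∧ y.SecretKeysOnlyAsKeys
  | .enc x _ => x.SecretKeysOnlyAsKeys

/-- The inverse of a key. -/
def RunTerm.inv : RunTerm M → RunTerm M
  | .fn f n args => .fn (M.inv f) n args
  | t => t

/-- Events. `send l r r' x`: role `r` sends `x` to `r'`. `read l r r' x`: role `r'` receives `x`,
apparently from `r`. `claim l r c x`: role `r` claims `c`, with optional argument `x`.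
`create` and `finish` start and end a role. -/
inductive Event (M : Signature.{u}) : Type u
  | create (l : M.Label) (r : M.Role)
  | send (l : M.Label) (r r' : M.Role) (x : RoleTerm M)
  | read (l : M.Label) (r r' : M.Role) (x : RoleTerm M)
  | claim (l : M.Label) (r : M.Role) (c : M.Claim) (x : Option (RoleTerm M))
  | finish (l : M.Label) (r : M.Role)

namespace Event

def label : Event M → M.Label
  | create l _ => l
  | send l _ _ _ => l
  | read l _ _ _ => l
  | claim l _ _ _ => l
  | finish l _ => l

/-- The role that executes the event. -/
def actor : Event M → M.Role
  | create _ r => r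
  | send _ r _ _ => r
  | read _ _ r' _ => r'
  | claim _ r _ _ => r
  | finish _ r => r

/-- The role terms (at most one) that an event carries. -/
def terms : Event M → Set (RoleTerm M)
  | create _ _ => ∅
  | send _ _ _ x => {x}
  | read _ _ _ x => {x}
  | claim _ _ _ x => {y | x = some y}
  | finish _ _ => ∅

/-- The event is a send or a read event with message `x`. -/
def IsMessage (ev : Event M) (x : RoleTerm M) : Prop :=
  ∃ l r r', ev = send l r r' x ∨ ev = read l r r' x

def IsCreateOrEnd (ev : Event M) : Prop :=
  ∃ l r, ev = create l r ∨ ev = finish l r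

/-- A send event and the corresponding read event. -/
def Corresponding (ev ev' : Event M) : Prop :=
  ∃ l r r' x x', ev = send l r r' x ∧ ev' = read l r r' x'

end Event

inductive IdType
  | const
  | var
  | param

/-- A role specification: a list of events and a partial function that types identifiers. -/
structure RoleSpec (M : Signature.{u}) where
  events : List (Event M)
  typing : M.Id → Option IdType

/-- Well-formed specification of the role with name `r`. -/
structure RoleSpec.WellFormed (rs : RoleSpec M) (r : M.Role) : Prop where
  /-- There is exactly one create and one end event, first and last in the list. -/
  shape : ∃ l l' es, rs.events = Event.create l r :: (es ++ [Event.finish l' r]) ∧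
    ∀ ev ∈ es, ¬ ev.IsCreateOrEnd
  actor_eq : ∀ ev ∈ rs.events, ev.actor = r
  /-- Exactly the identifiers that appear in the list are typed. -/
  typed : ∀ c, (rs.typing c).isSome ↔ ∃ ev ∈ rs.events, ∃ x ∈ ev.terms, c ∈ x.idents
  fnLongTerm : ∀ ev ∈ rs.events, ∀ x ∈ ev.terms, x.FnLongTerm
  secretKeys : ∀ ev ∈ rs.events, ∀ x, ev.IsMessage x → x.SecretKeysOnlyAsKeys

/-- A protocol: a partial map from role names to role specifications. -/
abbrev Protocol (M : Signature.{u}) := M.Role → Option (RoleSpec M)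

def Protocol.HasEvent (P : Protocol M) (ev : Event M) : Prop :=
  ∃ r rs, P r = some rs ∧ ev ∈ rs.events

/-- The label `l` is used in `P`. -/
def Protocol.HasLabel (P : Protocol M) (l : M.Label) : Prop :=
  ∃ ev, P.HasEvent ev ∧ ev.label = l

structure Protocol.WellFormed (P : Protocol M) : Prop where
  role_wf : ∀ r rs, P r = some rs → rs.WellFormed r
  /-- Labels are unique, except that corresponding send and read events share theirs. -/
  label_unique : ∀ (r : M.Role) (rs : RoleSpec M) (i : ℕ) (ev : Event M)
      (r' : M.Role) (rs' : RoleSpec M) (i' : ℕ) (ev' : Event M),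
    P r = some rs → rs.events[i]? = some ev → P r' = some rs' → rs'.events[i']? = some ev' →
    ev.label = ev'.label →
    (r = r' ∧ i = i') ∨ Event.Corresponding ev ev' ∨ Event.Corresponding ev' ev

/-- The label `l` is used in some protocol of `S`. -/
def HasLabel (S : Set (Protocol M)) (l : M.Label) : Prop := ∃ P ∈ S, P.HasLabel l

/-- Protocol sets: well-formed protocols, no two of which share a label. -/
structure IsProtocolSet (S : Set (Protocol M)) : Prop where
  wf : ∀ P ∈ S, P.WellFormed
  label_disjoint : ∀ P ∈ S, ∀ Q ∈ S, ∀ l, P.HasLabel l → Q.HasLabel l → P = Q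

/-- An instantiation `(rid, ρ, σ)`. Only nonce run terms are assigned to variables and
parameters. -/
@[ext]
structure Inst (M : Signature.{u}) where
  rid : M.RunId
  ρ : M.Role → Option M.Agent
  σ : M.Id → Option (Nonce M)

/-- `inst.Eval ty x t`: in the context of the typing `ty`, `inst(x)` is defined and equals `t`. -/
inductive Inst.Eval (inst : Inst M) (ty : M.Id → Option IdType) : RoleTerm M → RunTerm M → Prop
  | role {r a} : inst.ρ r = some a → Eval inst ty (.role r) (.agent a)
  | const {c} : ty c = some .const → Eval inst ty (.ident c) (.nonce (.fresh c inst.rid))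
  | var {c n} : ty c = some .var → inst.σ c = some n → Eval inst ty (.ident c) (.nonce n)
  | param {c n} : ty c = some .param → inst.σ c = some n → Eval inst ty (.ident c) (.nonce n)
  | fn {f n xs ts} : (∀ i, Eval inst ty (xs i) (ts i)) → Eval inst ty (.fn f n xs) (.fn f n ts)
  | pair {x y t v} : Eval inst ty x t → Eval inst ty y v → Eval inst ty (.pair x y) (.pair t v)
  | enc {x y t v} : Eval inst ty x t → Eval inst ty y v → Eval inst ty (.enc x y) (.enc t v)

/-- `ty` is the typing of the role specification in `S` to which the event `ev` belongs. -/
def IsTyping (S : Set (Protocol M)) (ev : Event M) (ty : M.Id → Option IdType) : Prop :=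
  ∃ P ∈ S, ∃ r rs, P r = some rs ∧ ev ∈ rs.events ∧ ty = rs.typing

/-- A run: an instantiation and the events that remain to be executed. -/
abbrev Run (M : Signature.{u}) := Inst M × List (Event M)

abbrev RunEvent (M : Signature.{u}) := Inst M × Event M

abbrev Trace (M : Signature.{u}) := List (RunEvent M)

/-- Initial runs of roles of protocols in `S`. -/
def IsInitialRun (S : Set (Protocol M)) (run : Run M) : Prop :=
  ∃ P ∈ S, ∃ r rs, P r = some rs ∧ run.2 = rs.events ∧
    (∀ r', (run.1.ρ r').isSome ↔ (P r').isSome) ∧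
    (∀ c, (run.1.σ c).isSome ↔ rs.typing c = some .param)

/-- The Dolev-Yao closure of a set of run terms. -/
inductive Closure (K : Set (RunTerm M)) : RunTerm M → Prop
  | base {t} : t ∈ K → Closure K t
  | encrypt {t v} : Closure K t → Closure K v → Closure K (.enc t v)
  | decrypt {t v} : Closure K (.enc t v) → Closure K v.inv → Closure K t
  | pair {t v} : Closure K t → Closure K v → Closure K (.pair t v)
  | fst {t v} : Closure K (.pair t v) → Closure K t
  | snd {t v} : Closure K (.pair t v) → Closure K v

/-- What the intruder is given: agent names, intruder-generated terms, the public keys, and the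
compromised long-term keys. -/
inductive InitialTerm : RunTerm M → Prop
  | agent (a : M.Agent) : InitialTerm (.agent a)
  | intruder (a : M.IT) : InitialTerm (.nonce (.intruder a))
  | pub {f n} (args : Fin n → RunTerm M) : f ∈ M.isPublic → InitialTerm (.fn f n args)
  | compromised {f n} (args : Fin n → M.Agent) : args ∈ M.compromised f n →
      InitialTerm (.fn f n fun i => .agent (args i))

/-- A state of the system: the intruder knowledge and the active runs. -/
structure State (M : Signature.{u}) where
  IK : Set (RunTerm M)
  F : Set (Run M)

def initialState : State M := ⟨{t | Closure {t' | InitialTerm t'} t}, ∅⟩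

/-- `F[new/old]`. -/
def replaceRun (F : Set (Run M)) (new old : Run M) : Set (Run M) := (F \ {old}) ∪ {new}

/-- `inst'` extends `inst` on the variables of `m` so that the pattern `m` matches `t`. -/
def Match (ty : M.Id → Option IdType) (inst : Inst M) (m : RoleTerm M) (t : RunTerm M)
    (inst' : Inst M) : Prop :=
  inst'.rid = inst.rid ∧ inst'.ρ = inst.ρ ∧
  (∀ c n, inst.σ c = some n → inst'.σ c = some n) ∧
  (∀ c, (inst'.σ c).isSome ↔
    ((inst.σ c).isSome ∨ (c ∈ m.idents ∧ ty c = some .var))) ∧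
  inst'.Eval ty m t

/-- The transition relation of the system that executes the protocol set `S`. -/
inductive Step (S : Set (Protocol M)) : State M → RunEvent M → State M → Prop
  | create {IK F inst l r es} :
      IsInitialRun S (inst, .create l r :: es) →
      (∀ run ∈ F, run.1.rid ≠ inst.rid) →
      Step S ⟨IK, F⟩ (inst, .create l r) ⟨IK, F ∪ {(inst, es)}⟩
  | finish {IK F inst l r} :
      (inst, [.finish l r]) ∈ F →
      Step S ⟨IK, F⟩ (inst, .finish l r) ⟨IK, replaceRun F (inst, []) (inst, [.finish l r])⟩
  | send {IK F inst l r r' m es ty t} :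
      (inst, .send l r r' m :: es) ∈ F →
      IsTyping S (.send l r r' m) ty → inst.Eval ty m t →
      Step S ⟨IK, F⟩ (inst, .send l r r' m)
        ⟨{t' | Closure (IK ∪ {t}) t'},
          replaceRun F (inst, es) (inst, .send l r r' m :: es)⟩
  | read {IK F inst inst' l r r' m es ty t} :
      (inst, .read l r r' m :: es) ∈ F →
      t ∈ IK →
      IsTyping S (.read l r r' m) ty → Match ty inst m t inst' →
      Step S ⟨IK, F⟩ (inst', .read l r r' m)
        ⟨IK, replaceRun F (inst', es) (inst, .read l r r' m :: es)⟩
  | claim {IK F inst l r c x es} :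
      (inst, .claim l r c x :: es) ∈ F →
      Step S ⟨IK, F⟩ (inst, .claim l r c x)
        ⟨IK, replaceRun F (inst, es) (inst, .claim l r c x :: es)⟩

/-- `Execution S α st`: the trace `α` leads from the initial state to the state `st`. -/
inductive Execution (S : Set (Protocol M)) : Trace M → State M → Prop
  | nil : Execution S [] initialState
  | snoc {α st e st'} : Execution S α st → Step S st e st' → Execution S (α ++ [e]) st'

/-- The set of valid traces for the protocol set `S`. -/
def Tr (S : Set (Protocol M)) : Set (Trace M) := {α | ∃ st, Execution S α st}

/-- The intruder knowledge after the execution of `α`. -/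
def knowledge (S : Set (Protocol M)) (α : Trace M) : Set (RunTerm M) :=
  {t | ∃ st, Execution S α st ∧ t ∈ st.IK}

/-- The event of a run event is a send event with message `m`. -/
def IsSend (ev : Event M) (m : RoleTerm M) : Prop := ∃ l r r', ev = .send l r r' m

/-- `S₁` and `S₂` are independent in the context of the trace restriction `χ`: an encryption
term sent by one of them coincides with no encryption term read, sent or claimed by the other. -/
def IndependentIn (χ : Trace M → Prop) (S₁ S₂ : Set (Protocol M)) : Prop :=
  Disjoint S₁ S₂ ∧
  ∀ α ∈ Tr (S₁ ∪ S₂), χ α →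
    ∀ (inst inst' : Inst M) (ev ev' : Event M) (m m' x y x' y' : RoleTerm M)
      (ty ty' : M.Id → Option IdType) (t : RunTerm M),
      (inst, ev) ∈ α → (inst', ev') ∈ α →
      IsSend ev m → m' ∈ ev'.terms →
      IsTyping (S₁ ∪ S₂) ev ty → IsTyping (S₁ ∪ S₂) ev' ty' →
      RoleTerm.Subterm (.enc x y) m → RoleTerm.Subterm (.enc x' y') m' →
      inst.Eval ty (.enc x y) t → inst'.Eval ty' (.enc x' y') t →
      (HasLabel S₁ ev.label ∧ HasLabel S₁ ev'.label) ∨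
      (HasLabel S₂ ev.label ∧ HasLabel S₂ ev'.label)

/-- In the trace `α`, the run `rid` is a run of a role of a protocol in `S`, and `c` is a constant
of that role. -/
def IsConstantOf (S : Set (Protocol M)) (α : Trace M) (c : M.Id) (rid : M.RunId) : Prop :=
  ∃ inst l r ty, (inst, Event.create l r) ∈ α ∧ inst.rid = rid ∧
    IsTyping S (.create l r) ty ∧ ty c = some .const

/-- In the trace `α` of `S₁ ∪ S₂`, no secret input is passed from `S₁` to `S₂`: when a run of a
protocol in `S₂` is created, the nonce run terms given to its parameters are no constants of runs
of protocols in `S₁`, unless the intruder already knows them. -/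
def NoSecretInput (S₁ S₂ : Set (Protocol M)) (α : Trace M) : Prop :=
  ∀ i inst l r, α[i]? = some (inst, Event.create l r) → HasLabel S₂ l →
    ∀ d c rid, inst.σ d = some (.fresh c rid) → IsConstantOf S₁ α c rid →
      RunTerm.nonce (.fresh c rid) ∈ knowledge (S₁ ∪ S₂) (α.take i)

/-- A security property: a predicate on instantiations and traces that depends on a protocol set
and a claim event. -/
abbrev SecurityProperty (M : Signature.{u}) :=
  Set (Protocol M) → Event M → Inst M → Trace M → Prop

/-- Under the trace restriction `χ`, `S` satisfies the claim with label `l`, where `f c` is the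
security property that belongs to the claim `c`. Claims in sessions with an untrusted agent are
not evaluated. -/
def SatisfiesIn (f : M.Claim → SecurityProperty M) (χ : Trace M → Prop)
    (S : Set (Protocol M)) (l : M.Label) : Prop :=
  ∀ α ∈ Tr S, χ α → ∀ inst r c x, (inst, Event.claim l r c x) ∈ α →
    f c S (.claim l r c x) inst α ∨ ¬ (∀ r' a, inst.ρ r' = some a → a ∈ M.trusted)

/-- `S` satisfies the claim with label `l`. -/
def Satisfies (f : M.Claim → SecurityProperty M) (S : Set (Protocol M)) (l : M.Label) : Prop :=
  SatisfiesIn f (fun _ => True) S l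

open Classical in
/-- The map `π_P`, which removes from a trace all events that do not belong to `P`. -/
noncomputable def proj (P : Protocol M) (α : Trace M) : Trace M :=
  α.filter fun e => decide (P.HasLabel e.2.label)

/-- The instantiation `s ∘ inst` for a renaming `s` of nonce run terms. -/
def Inst.rename (s : Equiv.Perm (Nonce M)) (inst : Inst M) : Inst M :=
  ⟨inst.rid, inst.ρ, fun c => (inst.σ c).map s⟩

/-- The renaming `s` leaves the constants of the run with instantiation `inst` alone. This is what
makes the composition of `s` with the map `x ↦ inst(x)` the map given by the instantiation
`inst.rename s`. -/
def RespectsConstants (s : Equiv.Perm (Nonce M)) (ty : M.Id → Option IdType) (inst : Inst M) :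
    Prop :=
  ∀ c, ty c = some .const → s (.fresh c inst.rid) = .fresh c inst.rid

/-- `s(α) = α'`, for a renaming `s` of nonce run terms and traces of events of `P`. -/
def RenamesTrace (P : Protocol M) (s : Equiv.Perm (Nonce M)) (α α' : Trace M) : Prop :=
  (∀ e ∈ α, ∀ ty, IsTyping {P} e.2 ty → RespectsConstants s ty e.1) ∧
  α' = α.map fun e => (e.1.rename s, e.2)

/-- The security property `g` of the claim `c` is protocol-centric: whether it holds is determined,
up to renaming of nonce run terms, by the events in the trace of the protocol in which the claim
occurs. -/
def ProtocolCentric (c : M.Claim) (g : SecurityProperty M) : Prop :=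
  ∀ (S S' : Set (Protocol M)), IsProtocolSet S → IsProtocolSet S' →
  ∀ P ∈ S, P ∈ S' → ∀ (l : M.Label) (r : M.Role) (x : Option (RoleTerm M)),
    P.HasEvent (.claim l r c x) →
  ∀ (s : Equiv.Perm (Nonce M)), ∀ α ∈ Tr S, ∀ α' ∈ Tr S', ∀ inst : Inst M,
    (∀ ty, IsTyping {P} (.claim l r c x) ty → RespectsConstants s ty inst) →
    RenamesTrace P s (proj P α) (proj P α') →
    (g S (.claim l r c x) inst α ↔ g S' (.claim l r c x) (inst.rename s) α')

end SecProt

namespace SecProt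

variable {M : Signature.{u}}

/-! ### Protocol sets -/

/-! From a trace `α` of `S₁ ∪ S₂` one deletes the events of `S₂` and renames the nonces assigned to
identifiers. The result is a trace of `S₁`, in which the claim holds, and protocol-centricity
carries it back to `α`. The point is that the intruder can supply every message that `S₁` reads in
`α` without the help of `S₂`.

To see this, let `h` fix the constants of `S₁`-runs and make all other nonces intruder-generated,
and let `replaceEnc` apply `h` and replace each encryption in the content of an `S₂`-message by one
intruder-generated term. By independence no encryption of `S₁` is replaced, so messages of `S₁` are
only renamed (`Removable.eval_rename`). A message sent by `S₂` becomes known: outside replaced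
encryptions it consists of agent names, public keys and nonces (`Inst.Eval.replaceEnc_mem`).
Intruder deductions survive the replacement; the critical case is the decryption of a replaced
encryption, whose body becomes known in the same way (`replaceEnc_mem_of_closure`,
`Simulates.replaceEnc_mem`).

It remains to know `h n` for every nonce `n` used by `S₂`. For constants this is the choice of `h`,
for parameters the absence of secret input. For variables, independence implies that an encryption
read by `S₂` was built by the intruder or sent by `S₂` itself (`Simulates.nonce_mem_of_read`).

Protocol-centricity asks for a bijection, which `h` need not be. But only finitely many nonces are
values of identifiers in `α`, and on these `h` agrees with a permutation `s`
(`exists_perm_intruder`). `Simulates.snoc` is the inductive step that puts this together. -/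

theorem RoleTerm.finite_idents (x : RoleTerm M) : x.idents.Finite := by
  induction x with
  | ident c => exact Set.finite_singleton c
  | role r => exact Set.finite_empty
  | fn f n args ih => exact Set.finite_iUnion ih
  | pair x y hx hy => exact hx.union hy
  | enc x y hx hy => exact hx.union hy

theorem Event.finite_terms (ev : Event M) : ev.terms.Finite := by
  cases ev with
  | create l r => exact Set.finite_empty
  | send l r r' x => exact Set.finite_singleton x
  | read l r r' x => exact Set.finite_singleton x
  | claim l r c x =>
    refine Set.Subsingleton.finite fun y hy z hz => ?_
    simp only [terms, Set.mem_ofPred_eq] at hy hz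
    simpa [hy] using hz
  | finish l r => exact Set.finite_empty

theorem RoleSpec.WellFormed.finite_typed {rs : RoleSpec M} {r : M.Role} (h : rs.WellFormed r) :
    {c | (rs.typing c).isSome}.Finite := by
  have : {c | (rs.typing c).isSome} = ⋃ ev ∈ {ev | ev ∈ rs.events}, ⋃ x ∈ ev.terms, x.idents := by
    ext c
    simp [h.typed c]
  rw [this]
  exact (List.finite_toSet _).biUnion fun ev _ =>
    ev.finite_terms.biUnion fun x _ => x.finite_idents

/-- The event `ev` belongs to some protocol of `S`. -/
def HasEvent (S : Set (Protocol M)) (ev : Event M) : Prop := ∃ P ∈ S, P.HasEvent ev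

theorem HasEvent.hasLabel {S : Set (Protocol M)} {ev : Event M} (h : HasEvent S ev) :
    HasLabel S ev.label :=
  let ⟨P, hP, he⟩ := h
  ⟨P, hP, ev, he, rfl⟩

theorem IsTyping.hasEvent {S : Set (Protocol M)} {ev : Event M} {ty : M.Id → Option IdType}
    (h : IsTyping S ev ty) : HasEvent S ev :=
  let ⟨P, hP, r, rs, hr, he, _⟩ := h
  ⟨P, hP, r, rs, hr, he⟩

theorem IsTyping.mono {S T : Set (Protocol M)} (hST : S ⊆ T) {ev : Event M}
    {ty : M.Id → Option IdType} (h : IsTyping S ev ty) : IsTyping T ev ty :=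
  let ⟨P, hP, h'⟩ := h
  ⟨P, hST hP, h'⟩

theorem IsProtocolSet.mono {S T : Set (Protocol M)} (hST : S ⊆ T) (hT : IsProtocolSet T) :
    IsProtocolSet S :=
  ⟨fun P hP => hT.wf P (hST hP), fun P hP Q hQ => hT.label_disjoint P (hST hP) Q (hST hQ)⟩

theorem IsProtocolSet.eq_of_label {S : Set (Protocol M)} (hS : IsProtocolSet S) {P Q : Protocol M}
    (hP : P ∈ S) (hQ : Q ∈ S) {ev ev' : Event M} (he : P.HasEvent ev) (he' : Q.HasEvent ev')
    (hl : ev.label = ev'.label) : P = Q :=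
  hS.label_disjoint P hP Q hQ ev.label ⟨ev, he, rfl⟩ ⟨ev', he', hl.symm⟩

theorem Event.not_corresponding_self (ev : Event M) : ¬ ev.Corresponding ev := by
  rintro ⟨l, r, r', x, x', h, h'⟩
  rw [h] at h'
  cases h'

/-- The exception to label uniqueness pairs a send with a read event, so it never applies to an
event and itself. -/
theorem IsProtocolSet.spec_unique {S : Set (Protocol M)} (hS : IsProtocolSet S) {P Q : Protocol M}
    (hP : P ∈ S) (hQ : Q ∈ S) {r r' : M.Role} {rs rs' : RoleSpec M} (hr : P r = some rs)
    (hr' : Q r' = some rs') {ev : Event M} (he : ev ∈ rs.events) (he' : ev ∈ rs'.events) :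
    P = Q ∧ rs = rs' := by
  obtain rfl := hS.eq_of_label hP hQ ⟨r, rs, hr, he⟩ ⟨r', rs', hr', he'⟩ rfl
  obtain ⟨i, hi⟩ := List.mem_iff_getElem?.1 he
  obtain ⟨j, hj⟩ := List.mem_iff_getElem?.1 he'
  rcases (hS.wf P hP).label_unique r rs i ev r' rs' j ev hr hi hr' hj rfl with h | h | h
  · obtain ⟨rfl, -⟩ := h
    exact ⟨rfl, Option.some.inj (hr.symm.trans hr')⟩
  · exact absurd h ev.not_corresponding_self
  · exact absurd h ev.not_corresponding_self

theorem IsProtocolSet.typing_unique {S : Set (Protocol M)} (hS : IsProtocolSet S) {ev : Event M}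
    {ty ty' : M.Id → Option IdType} (h : IsTyping S ev ty) (h' : IsTyping S ev ty') : ty = ty' := by
  obtain ⟨P, hP, r, rs, hr, he, rfl⟩ := h
  obtain ⟨Q, hQ, r', rs', hr', he', rfl⟩ := h'
  rw [(hS.spec_unique hP hQ hr hr' he he').2]

/-- An event that carries the label of a claim event of a protocol set is that claim event. -/
theorem IsProtocolSet.claim_unique {S : Set (Protocol M)} (hS : IsProtocolSet S) {l : M.Label}
    {r : M.Role} {c : M.Claim} {x : Option (RoleTerm M)} {ev : Event M}
    (h : HasEvent S (.claim l r c x)) (h' : HasEvent S ev) (hl : ev.label = l) :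
    ev = .claim l r c x := by
  obtain ⟨P, hP, r₁, rs₁, hr₁, he₁⟩ := h
  obtain ⟨Q, hQ, r₂, rs₂, hr₂, he₂⟩ := h'
  obtain rfl := hS.eq_of_label hP hQ ⟨r₁, rs₁, hr₁, he₁⟩ ⟨r₂, rs₂, hr₂, he₂⟩ hl.symm
  obtain ⟨i, hi⟩ := List.mem_iff_getElem?.1 he₁
  obtain ⟨j, hj⟩ := List.mem_iff_getElem?.1 he₂
  rcases (hS.wf P hP).label_unique _ _ _ _ _ _ _ _ hr₁ hi hr₂ hj hl.symm with h | h | h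
  · obtain ⟨rfl, rfl⟩ := h
    rw [hr₁, Option.some.injEq] at hr₂
    rw [hr₂, hj] at hi
    exact Option.some.inj hi
  · obtain ⟨_, _, _, _, _, h, -⟩ := h
    cases h
  · obtain ⟨_, _, _, _, _, -, h⟩ := h
    cases h

theorem HasEvent.of_label {S T : Set (Protocol M)} (hT : IsProtocolSet T) (hST : S ⊆ T)
    {ev : Event M} (h : HasEvent T ev) (hl : HasLabel S ev.label) : HasEvent S ev := by
  obtain ⟨P, hP, he⟩ := h
  obtain ⟨Q, hQ, hl⟩ := hl
  obtain rfl := hT.label_disjoint P hP Q (hST hQ) ev.label ⟨ev, he, rfl⟩ hl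
  exact ⟨P, hQ, he⟩

theorem IsTyping.of_hasEvent {S T : Set (Protocol M)} (hT : IsProtocolSet T) (hST : S ⊆ T)
    {ev : Event M} {ty : M.Id → Option IdType} (h : IsTyping T ev ty) (he : HasEvent S ev) :
    IsTyping S ev ty := by
  obtain ⟨P, hP, r, rs, hr, he'⟩ := he
  have h' : IsTyping S ev rs.typing := ⟨P, hP, r, rs, hr, he', rfl⟩
  rwa [hT.typing_unique h (h'.mono hST)]

theorem not_hasEvent_of_disjoint {S₁ S₂ : Set (Protocol M)} (hS : IsProtocolSet (S₁ ∪ S₂))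
    (hd : Disjoint S₁ S₂) {ev ev' : Event M} (hl : ev.label = ev'.label) (h₁ : HasEvent S₁ ev)
    (h₂ : HasEvent S₂ ev') : False := by
  obtain ⟨P, hP, he⟩ := h₁
  obtain ⟨Q, hQ, he'⟩ := h₂
  obtain rfl := hS.eq_of_label (.inl hP) (.inr hQ) he he' hl
  exact Set.disjoint_left.1 hd hP hQ

theorem not_hasLabel_of_disjoint {S₁ S₂ : Set (Protocol M)} (hS : IsProtocolSet (S₁ ∪ S₂))
    (hd : Disjoint S₁ S₂) {l : M.Label} (h₁ : HasLabel S₁ l) (h₂ : HasLabel S₂ l) : False := by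
  obtain ⟨P, hP, ev, he, rfl⟩ := h₁
  obtain ⟨Q, hQ, ev', he', hl⟩ := h₂
  exact not_hasEvent_of_disjoint hS hd hl.symm ⟨P, hP, he⟩ ⟨Q, hQ, he'⟩

/-! ### Terms -/

theorem Inst.Eval.unique {inst : Inst M} {ty : M.Id → Option IdType} {x : RoleTerm M}
    {t t' : RunTerm M} (h : inst.Eval ty x t) (h' : inst.Eval ty x t') : t = t' := by
  induction h generalizing t' with
  | role hr => cases h' with | role hr' => rw [hr, Option.some.injEq] at hr'; rw [hr']
  | const hc =>
    cases h' with
    | const => rfl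
    | var hv => simp [hc] at hv
    | param hv => simp [hc] at hv
  | var hc hn =>
    cases h' with
    | const hv => simp [hc] at hv
    | var _ hn' => rw [hn, Option.some.injEq] at hn'; rw [hn']
    | param hv => simp [hc] at hv
  | param hc hn =>
    cases h' with
    | const hv => simp [hc] at hv
    | param _ hn' => rw [hn, Option.some.injEq] at hn'; rw [hn']
    | var hv => simp [hc] at hv
  | fn _ ih => cases h' with | fn h' => rw [funext fun i => ih i (h' i)]
  | pair _ _ ih ih' => cases h' with | pair h h' => rw [ih h, ih' h']
  | enc _ _ ih ih' => cases h' with | enc h h' => rw [ih h, ih' h']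

theorem RoleTerm.Subterm.trans {x y z : RoleTerm M} (h : x.Subterm y) (h' : y.Subterm z) :
    x.Subterm z := by
  induction h' with
  | refl => exact h
  | pair_left _ ih => exact .pair_left ih
  | pair_right _ ih => exact .pair_right ih
  | enc_left _ ih => exact .enc_left ih
  | enc_right _ ih => exact .enc_right ih

/-- The nonces of a run term that are not arguments of functions. -/
def RunTerm.nonces : RunTerm M → Set (Nonce M)
  | .agent _ => ∅
  | .fn _ _ _ => ∅
  | .nonce n => {n}
  | .pair t v => t.nonces ∪ v.nonces
  | .enc t v => t.nonces ∪ v.nonces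

/-- `u.Content t`: the term `u` is part of `t`, and not only part of the keys used in `t`. -/
inductive RunTerm.Content : RunTerm M → RunTerm M → Prop
  | refl (t) : Content t t
  | pair_left {u t v} : Content u t → Content u (.pair t v)
  | pair_right {u t v} : Content u v → Content u (.pair t v)
  | enc {u t v} : Content u t → Content u (.enc t v)

theorem RunTerm.Content.trans {t u v : RunTerm M} (h : t.Content u) (h' : u.Content v) :
    t.Content v := by
  induction h' with
  | refl => exact h
  | pair_left _ ih => exact .pair_left ih
  | pair_right _ ih => exact .pair_right ih
  | enc _ ih => exact .enc ih

/-- Identifiers stand for nonces only, so pairs and encryptions in a message already occur in its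
template. Content never descends into keys, which is why the condition on secret keys is inherited.
-/
theorem Inst.Eval.exists_of_content {inst : Inst M} {ty : M.Id → Option IdType} {x : RoleTerm M}
    {t u : RunTerm M} (h : inst.Eval ty x t) (hu : u.Content t) :
    ∃ y, y.Subterm x ∧ inst.Eval ty y u ∧
      (x.SecretKeysOnlyAsKeys → y.SecretKeysOnlyAsKeys) := by
  induction hu generalizing x with
  | refl => exact ⟨x, .refl x, h, id⟩
  | pair_left _ ih =>
    cases h with
    | pair h _ =>
      obtain ⟨y, hy, he, hs⟩ := ih h
      exact ⟨y, .pair_left hy, he, fun hx => hs hx.1⟩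
  | pair_right _ ih =>
    cases h with
    | pair _ h =>
      obtain ⟨y, hy, he, hs⟩ := ih h
      exact ⟨y, .pair_right hy, he, fun hx => hs hx.2⟩
  | enc _ ih =>
    cases h with
    | enc h _ =>
      obtain ⟨y, hy, he, hs⟩ := ih h
      exact ⟨y, .enc_left hy, he, fun hx => hs hx⟩

/-- In the context of the typing `ty`, the constants and all values of `inst` lie in `N`. -/
def Inst.NoncesIn (inst : Inst M) (ty : M.Id → Option IdType) (N : Set (Nonce M)) : Prop :=
  (∀ c, ty c = some .const → .fresh c inst.rid ∈ N) ∧ ∀ c n, inst.σ c = some n → n ∈ N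

theorem Inst.Eval.nonces_subset {inst : Inst M} {ty : M.Id → Option IdType} {x : RoleTerm M}
    {t : RunTerm M} (h : inst.Eval ty x t) {N : Set (Nonce M)} (hN : inst.NoncesIn ty N) :
    t.nonces ⊆ N := by
  induction h with
  | role => exact Set.empty_subset _
  | const hc => exact Set.singleton_subset_iff.2 (hN.1 _ hc)
  | var _ hn => exact Set.singleton_subset_iff.2 (hN.2 _ _ hn)
  | param _ hn => exact Set.singleton_subset_iff.2 (hN.2 _ _ hn)
  | fn => exact Set.empty_subset _
  | pair _ _ ih ih' => exact Set.union_subset ih ih'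
  | enc _ _ ih ih' => exact Set.union_subset ih ih'

/-- `FnLongTerm` keeps the variable out of the arguments of functions, where `nonces` does not look.
-/
theorem Inst.Eval.mem_nonces {inst : Inst M} {ty : M.Id → Option IdType} {x : RoleTerm M}
    {t : RunTerm M} (h : inst.Eval ty x t) (hx : x.FnLongTerm) {c : M.Id} {n : Nonce M}
    (hc : c ∈ x.idents) (hty : ty c = some .var) (hn : inst.σ c = some n) : n ∈ t.nonces := by
  induction h with
  | role => exact absurd hc (Set.notMem_empty _)
  | const hc' => rw [Set.mem_singleton_iff.1 hc, hc'] at hty; cases hty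
  | var _ hn' =>
    rw [Set.mem_singleton_iff.1 hc, hn', Option.some.injEq] at hn
    exact hn.symm
  | param _ hn' =>
    rw [Set.mem_singleton_iff.1 hc, hn', Option.some.injEq] at hn
    exact hn.symm
  | fn =>
    obtain ⟨i, hi⟩ := Set.mem_iUnion.1 hc
    rw [hx i] at hi
    exact absurd hi (Set.notMem_empty _)
  | pair _ _ ih ih' => exact hc.imp (ih hx.1) (ih' hx.2)
  | enc _ _ ih ih' => exact hc.imp (ih hx.1) (ih' hx.2)

open Classical in
/-- Apply `h` to the nonces of a term, and replace the encryptions in `B` by `d`. -/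
noncomputable def replaceEnc (h : Nonce M → Nonce M) (B : Set (RunTerm M)) (d : RunTerm M) :
    RunTerm M → RunTerm M
  | .agent a => .agent a
  | .fn f n args => .fn f n args
  | .nonce n => .nonce (h n)
  | .pair t v => .pair (replaceEnc h B d t) (replaceEnc h B d v)
  | .enc t v => if .enc t v ∈ B then d else .enc (replaceEnc h B d t) (replaceEnc h B d v)

section replaceEnc

variable {h : Nonce M → Nonce M} {B : Set (RunTerm M)} {d : RunTerm M}

theorem replaceEnc_enc_of_mem {t v : RunTerm M} (hB : .enc t v ∈ B) :
    replaceEnc h B d (.enc t v) = d := by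
  simp [replaceEnc, hB]

theorem replaceEnc_enc_of_notMem {t v : RunTerm M} (hB : .enc t v ∉ B) :
    replaceEnc h B d (.enc t v) = .enc (replaceEnc h B d t) (replaceEnc h B d v) := by
  simp [replaceEnc, hB]

/-- Inversion affects function terms only, and these are not touched by the replacement. An
encryption may become `d`, which therefore has to be its own inverse. -/
theorem replaceEnc_inv (hd : d.inv = d) (t : RunTerm M) :
    replaceEnc h B d t.inv = (replaceEnc h B d t).inv := by
  cases t with
  | enc t v =>
    by_cases hB : .enc t v ∈ B
    · rw [replaceEnc_enc_of_mem hB, hd]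
      exact replaceEnc_enc_of_mem hB
    · simp [RunTerm.inv, replaceEnc_enc_of_notMem hB]
  | _ => rfl

/-- Each deduction is repeated on the images, except at encryptions in `B`: building one gives `d`,
and the body of one, which cannot be extracted from `d`, is supplied by `hB`. -/
theorem replaceEnc_mem_of_closure {K K' : Set (RunTerm M)} (hK' : ∀ t, Closure K' t → t ∈ K')
    (hd : d ∈ K') (hd' : d.inv = d) (hbase : ∀ t ∈ K, replaceEnc h B d t ∈ K')
    (hB : ∀ t v, .enc t v ∈ B → replaceEnc h B d t ∈ K') {t : RunTerm M} (ht : Closure K t) :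
    replaceEnc h B d t ∈ K' := by
  induction ht with
  | base ht => exact hbase _ ht
  | @encrypt t v _ _ ih ih' =>
    by_cases hm : .enc t v ∈ B
    · rwa [replaceEnc_enc_of_mem hm]
    · rw [replaceEnc_enc_of_notMem hm]
      exact hK' _ (.encrypt (.base ih) (.base ih'))
  | @decrypt t v _ _ ih ih' =>
    by_cases hm : .enc t v ∈ B
    · exact hB _ _ hm
    · rw [replaceEnc_enc_of_notMem hm] at ih
      rw [replaceEnc_inv hd'] at ih'
      exact hK' _ (.decrypt (.base ih) (.base ih'))
  | pair _ _ ih ih' => exact hK' _ (.pair (.base ih) (.base ih'))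
  | fst _ ih => exact hK' _ (.fst (.base ih))
  | snd _ ih => exact hK' _ (.snd (.base ih))

/-- A message all of whose nonces are known, after application of `h`, is known after the
replacement of its encryptions. -/
theorem Inst.Eval.replaceEnc_mem {inst : Inst M} {ty : M.Id → Option IdType} {x : RoleTerm M}
    {t : RunTerm M} {K' : Set (RunTerm M)} (ht : inst.Eval ty x t) (hx : x.SecretKeysOnlyAsKeys)
    (hinit : ∀ t, InitialTerm t → t ∈ K') (hK' : ∀ t, Closure K' t → t ∈ K') (hd : d ∈ K')
    (hN : inst.NoncesIn ty {n | .nonce (h n) ∈ K'})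
    (hB : ∀ a b, RunTerm.Content (.enc a b) t → .enc a b ∈ B) : replaceEnc h B d t ∈ K' := by
  induction ht with
  | role => exact hinit _ (.agent _)
  | const hc => exact hN.1 _ hc
  | var _ hn => exact hN.2 _ _ hn
  | param _ hn => exact hN.2 _ _ hn
  | fn => exact hinit _ (.pub _ hx)
  | pair _ _ ih ih' =>
    exact hK' _ (.pair (.base (ih hx.1 fun a b hc => hB a b (.pair_left hc)))
      (.base (ih' hx.2 fun a b hc => hB a b (.pair_right hc))))
  -- Neither body nor key has to be known, so secret keys in key position do no harm.
  | enc => rwa [replaceEnc_enc_of_mem (hB _ _ (.refl _))]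

/-- Such a term depends on `ρ` alone. This covers the arguments of functions, which `replaceEnc`
leaves as they are. -/
theorem Inst.Eval.rename_of_idents_eq_empty {inst : Inst M} {ty : M.Id → Option IdType}
    {x : RoleTerm M} {t : RunTerm M} (ht : inst.Eval ty x t) (hx : x.idents = ∅)
    (s : Equiv.Perm (Nonce M)) : (inst.rename s).Eval ty x t := by
  induction ht with
  | role hr => exact .role hr
  | const => exact absurd hx (Set.singleton_ne_empty _)
  | var => exact absurd hx (Set.singleton_ne_empty _)
  | param => exact absurd hx (Set.singleton_ne_empty _)
  | fn _ ih => exact .fn fun i => ih i (Set.iUnion_eq_empty.1 hx i)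
  | pair _ _ ih ih' =>
    exact .pair (ih (Set.union_empty_iff.1 hx).1) (ih' (Set.union_empty_iff.1 hx).2)
  | enc _ _ ih ih' =>
    exact .enc (ih (Set.union_empty_iff.1 hx).1) (ih' (Set.union_empty_iff.1 hx).2)

/-- A message without encryptions in `B` is only renamed. -/
theorem Inst.Eval.rename {inst : Inst M} {ty : M.Id → Option IdType} {x : RoleTerm M}
    {t : RunTerm M} (ht : inst.Eval ty x t) (hx : x.FnLongTerm) {s : Equiv.Perm (Nonce M)}
    (hconst : ∀ c, ty c = some .const → h (.fresh c inst.rid) = .fresh c inst.rid)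
    (hσ : ∀ c n, inst.σ c = some n → h n = s n)
    (hB : ∀ y z u, RoleTerm.Subterm (.enc y z) x → inst.Eval ty (.enc y z) u → u ∉ B) :
    (inst.rename s).Eval ty x (replaceEnc h B d t) := by
  induction ht with
  | role hr => exact .role hr
  | const hc =>
    rw [replaceEnc, hconst _ hc]
    exact .const hc
  | var hc hn =>
    rw [replaceEnc, hσ _ _ hn]
    exact .var hc (by simp [Inst.rename, hn])
  | param hc hn =>
    rw [replaceEnc, hσ _ _ hn]
    exact .param hc (by simp [Inst.rename, hn])
  | fn ht _ => exact .fn fun i => (ht i).rename_of_idents_eq_empty (hx i) s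
  | pair _ _ ih ih' =>
    exact .pair (ih hx.1 fun y z u hs => hB y z u (.pair_left hs))
      (ih' hx.2 fun y z u hs => hB y z u (.pair_right hs))
  | enc he he' ih ih' =>
    rw [replaceEnc_enc_of_notMem (hB _ _ _ (.refl _) (.enc he he'))]
    exact .enc (ih hx.1 fun y z u hs => hB y z u (.enc_left hs))
      (ih' hx.2 fun y z u hs => hB y z u (.enc_right hs))

end replaceEnc

/-! ### Origin of encryptions in the intruder knowledge -/

theorem Closure.mono {K K' : Set (RunTerm M)} (hK : ∀ t ∈ K, Closure K' t) {t : RunTerm M}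
    (h : Closure K t) : Closure K' t := by
  induction h with
  | base ht => exact hK _ ht
  | encrypt _ _ ih ih' => exact .encrypt ih ih'
  | decrypt _ _ ih ih' => exact .decrypt ih ih'
  | pair _ _ ih ih' => exact .pair ih ih'
  | fst _ ih => exact .fst ih
  | snd _ ih => exact .snd ih

/-- Where an encryption known to the intruder comes from: the intruder constructed it, or it is part
of the content of a message. -/
theorem Closure.enc_origin {K : Set (RunTerm M)} {a b t : RunTerm M} (h : Closure K t)
    (hc : RunTerm.Content (.enc a b) t) :
    (Closure K a ∧ Closure K b) ∨ ∃ k ∈ K, RunTerm.Content (.enc a b) k := by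
  induction h with
  | base ht => exact .inr ⟨_, ht, hc⟩
  | encrypt h h' ih ih' =>
    cases hc with
    | refl => exact .inl ⟨h, h'⟩
    | enc hc => exact ih hc
  | decrypt _ _ ih _ => exact ih (.enc hc)
  | pair _ _ ih ih' =>
    cases hc with
    | pair_left hc => exact ih hc
    | pair_right hc => exact ih' hc
  | fst _ ih => exact ih (.pair_left hc)
  | snd _ ih => exact ih (.pair_right hc)

theorem InitialTerm.not_content_enc {t a b : RunTerm M} (h : InitialTerm t) :
    ¬ RunTerm.Content (.enc a b) t := by
  intro hc
  cases h <;> cases hc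

/-- For every finite set of nonces there is a renaming that makes them intruder-generated, with the
exception of those in a set `C` of constants, which it fixes. -/
theorem exists_perm_intruder [Infinite M.IT] (C : Set (Nonce M)) (hC : ∀ a, .intruder a ∉ C)
    {U : Set (Nonce M)} (hU : U.Finite) :
    ∃ s : Equiv.Perm (Nonce M), (∀ n ∈ C, s n = n) ∧
      ∀ n ∈ U, n ∉ C → s n ∈ Set.range Nonce.intruder := by
  classical
  -- Intruder-generated nonces must be free to move, as they are swapped away to make room. `C`
  -- contains none of them.
  suffices H : ∃ s : Equiv.Perm (Nonce M), (∀ n, n ∉ Set.range Nonce.intruder →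
      n ∉ U \ C → s n = n) ∧ ∀ n ∈ U \ C, s n ∈ Set.range Nonce.intruder by
    obtain ⟨s, h, h'⟩ := H
    refine ⟨s, fun n hn => h n ?_ fun h => h.2 hn, fun n hn hnC => h' n ⟨hn, hnC⟩⟩
    rintro ⟨a, rfl⟩
    exact hC a hn
  refine Set.Finite.induction_on _ (hU.subset Set.sdiff_subset) ?_ ?_
  · exact ⟨1, fun n _ _ => rfl, fun n hn => absurd hn (Set.notMem_empty n)⟩
  · rintro e E he hE ⟨s, h, h'⟩
    -- An intruder-generated nonce that is not yet a value of `s` on `E`; swapping it with `s e`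
    -- disturbs no earlier choice.
    obtain ⟨a, ha⟩ := ((hE.image s).preimage
      (f := Nonce.intruder) fun a _ b _ h => Nonce.intruder.inj h).exists_notMem
    by_cases hs : s e ∈ Set.range Nonce.intruder
    · refine ⟨s, fun n hn hn' => h n hn fun hE => hn' (.inr hE), ?_⟩
      rintro n (rfl | hn)
      · exact hs
      · exact h' n hn
    · refine ⟨s.trans (Equiv.swap (s e) (.intruder a)), fun n hn hn' => ?_, ?_⟩
      · have hsn := h n hn fun hE => hn' (.inr hE)
        rw [Equiv.trans_apply, hsn]
        refine Equiv.swap_apply_of_ne_of_ne (fun hne => hn' (.inl ?_)) fun hna => hn ⟨a, hna.symm⟩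
        exact s.injective (hsn.trans hne)
      · rintro n (rfl | hn)
        · exact ⟨a, by simp⟩
        · rw [Equiv.trans_apply, Equiv.swap_apply_of_ne_of_ne]
          · exact h' n hn
          · exact fun heq => hs (heq ▸ h' n hn)
          · exact fun heq => ha ⟨n, hn, heq⟩

/-! ### Executions -/

theorem mem_replaceRun {F : Set (Run M)} {new old run : Run M} :
    run ∈ replaceRun F new old ↔ (run ∈ F ∧ run ≠ old) ∨ run = new :=
  Iff.rfl

theorem exists_rid_of_replaceRun {F : Set (Run M)} {new old : Run M} (hold : old ∈ F)
    (hrid : new.1.rid = old.1.rid) {run : Run M} (h : run ∈ replaceRun F new old) :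
    ∃ run' ∈ F, run'.1.rid = run.1.rid := by
  rcases mem_replaceRun.1 h with h | rfl
  · exact ⟨run, h.1, rfl⟩
  · exact ⟨old, hold, hrid.symm⟩

theorem exists_rid_replaceRun {F : Set (Run M)} {new old : Run M}
    (hrid : new.1.rid = old.1.rid) {run : Run M} (h : run ∈ F) :
    ∃ run' ∈ replaceRun F new old, run'.1.rid = run.1.rid := by
  by_cases ho : run = old
  · exact ⟨new, .inr rfl, ho ▸ hrid⟩
  · exact ⟨run, .inl ⟨h, ho⟩, rfl⟩

/-- A step either creates a run or advances one. -/
theorem Step.create_or_advance {S : Set (Protocol M)} {st st' : State M} {e : RunEvent M}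
    (h : Step S st e st') :
    (∃ l r es, e.2 = .create l r ∧ IsInitialRun S (e.1, .create l r :: es) ∧
      (∀ run ∈ st.F, run.1.rid ≠ e.1.rid) ∧ st'.F = st.F ∪ {(e.1, es)}) ∨
    ∃ inst es, (∀ l r, e.2 ≠ .create l r) ∧ (inst, e.2 :: es) ∈ st.F ∧ e.1.rid = inst.rid ∧
      st'.F = replaceRun st.F (e.1, es) (inst, e.2 :: es) ∧
      ∀ c, (e.1.σ c).isSome → (inst.σ c).isSome ∨ ∃ x ∈ e.2.terms, c ∈ x.idents := by
  cases h with
  | create hi hr => exact .inl ⟨_, _, _, rfl, hi, hr, rfl⟩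
  | finish hF => exact .inr ⟨_, _, by simp, hF, rfl, rfl, fun c hc => .inl hc⟩
  | send hF => exact .inr ⟨_, _, by simp, hF, rfl, rfl, fun c hc => .inl hc⟩
  | read hF _ _ hm =>
    refine .inr ⟨_, _, by simp, hF, hm.1, rfl, fun c hc => ?_⟩
    exact ((hm.2.2.2.1 c).1 hc).imp_right fun h => ⟨_, rfl, h.1⟩
  | claim hF => exact .inr ⟨_, _, by simp, hF, rfl, rfl, fun c hc => .inl hc⟩

/-- `inst` belongs to a run of a role of `S` with specification `rs`, created in `α`. -/
structure IsRunOf (S : Set (Protocol M)) (α : Trace M) (inst : Inst M) (rs : RoleSpec M) :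
    Prop where
  spec : ∃ P ∈ S, ∃ r, P r = some rs
  created : ∃ inst₀ l r, (inst₀, Event.create l r) ∈ α ∧ inst₀.rid = inst.rid ∧
    .create l r ∈ rs.events
  typed : ∀ c, (inst.σ c).isSome → (rs.typing c).isSome

theorem IsRunOf.mono {S : Set (Protocol M)} {α β : Trace M} {inst : Inst M} {rs : RoleSpec M}
    (h : IsRunOf S α inst rs) (hαβ : α ⊆ β) : IsRunOf S β inst rs :=
  ⟨h.spec, let ⟨i, l, r, he, h'⟩ := h.created; ⟨i, l, r, hαβ he, h'⟩, h.typed⟩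

theorem IsRunOf.hasEvent {S : Set (Protocol M)} {α : Trace M} {inst : Inst M} {rs : RoleSpec M}
    (h : IsRunOf S α inst rs) {ev : Event M} (he : ev ∈ rs.events) : HasEvent S ev :=
  let ⟨P, hP, r, hr⟩ := h.spec
  ⟨P, hP, r, rs, hr, he⟩

/-- The runs and events of an execution belong to runs of role specifications, and no two runs
share their run identifier. -/
structure RunsValid (S : Set (Protocol M)) (α : Trace M) (st : State M) : Prop where
  runs : ∀ run ∈ st.F, ∃ rs, IsRunOf S α run.1 rs ∧ run.2 <:+ rs.events
  events : ∀ e ∈ α, ∃ rs, IsRunOf S α e.1 rs ∧ e.2 ∈ rs.events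
  rids : ∀ e ∈ α, ∃ run ∈ st.F, run.1.rid = e.1.rid
  create_unique : ∀ inst inst' l r l' r', (inst, Event.create l r) ∈ α →
    (inst', Event.create l' r') ∈ α → inst.rid = inst'.rid →
    Event.create (M := M) l r = Event.create l' r'

/-- Finished runs stay in the state with an empty list of events. Hence a fresh run identifier
differs from those of all earlier events, and a run has only one create event. -/
theorem Execution.runsValid {S : Set (Protocol M)} (hS : IsProtocolSet S) {α : Trace M}
    {st : State M} (h : Execution S α st) : RunsValid S α st := by
  induction h with
  | nil => exact ⟨fun run h => absurd h (Set.notMem_empty _), by simp, by simp, by simp⟩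
  | @snoc α st e st' _ hstep ih =>
    have hsub : α ⊆ α ++ [e] := List.subset_append_left _ _
    have hold : ∀ run ∈ st.F, ∃ rs, IsRunOf S (α ++ [e]) run.1 rs ∧ run.2 <:+ rs.events :=
      fun run hrun => let ⟨rs, h, h'⟩ := ih.runs run hrun; ⟨rs, h.mono hsub, h'⟩
    rcases hstep.create_or_advance with
      ⟨l, r, es, he, ⟨P, hP, r', rs, hr, hes, _, hσ⟩, hfresh, hF⟩ |
      ⟨inst, es, hne, hrun, hrid, hF, hσ⟩
    · have hnew : IsRunOf S (α ++ [e]) e.1 rs := by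
        refine ⟨⟨P, hP, r', hr⟩, ⟨e.1, l, r, by simp [← he], rfl, ?_⟩, fun c hc => ?_⟩
        · rw [← hes]
          exact List.mem_cons_self
        · rw [(hσ c).1 hc]
          rfl
      refine ⟨?_, ?_, ?_, ?_⟩
      · rw [hF]
        rintro run (hrun | rfl)
        · exact hold run hrun
        · exact ⟨rs, hnew, hes ▸ List.suffix_cons _ _⟩
      · intro e' he'
        rcases List.mem_append.1 he' with he' | he'
        · obtain ⟨rs', h, h'⟩ := ih.events e' he'
          exact ⟨rs', h.mono hsub, h'⟩
        · obtain rfl := List.mem_singleton.1 he'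
          exact ⟨rs, hnew, by rw [he, ← hes]; exact List.mem_cons_self⟩
      · intro e' he'
        rw [hF]
        rcases List.mem_append.1 he' with he' | he'
        · obtain ⟨run, hrun, hr⟩ := ih.rids e' he'
          exact ⟨run, .inl hrun, hr⟩
        · obtain rfl := List.mem_singleton.1 he'
          exact ⟨_, .inr rfl, rfl⟩
      · intro i i' l₁ r₁ l₂ r₂ h₁ h₂ hii
        rcases List.mem_append.1 h₁ with h₁ | h₁ <;> rcases List.mem_append.1 h₂ with h₂ | h₂
        · exact ih.create_unique i i' _ _ _ _ h₁ h₂ hii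
        · obtain ⟨run, hrun, hr⟩ := ih.rids _ h₁
          have h₂ := List.mem_singleton.1 h₂
          exact absurd (hr.trans (hii.trans (congrArg (fun e => e.1.rid) h₂))) (hfresh run hrun)
        · obtain ⟨run, hrun, hr⟩ := ih.rids _ h₂
          have h₁ := List.mem_singleton.1 h₁
          exact absurd (hr.trans (hii.symm.trans (congrArg (fun e => e.1.rid) h₁)))
            (hfresh run hrun)
        · exact congrArg Prod.snd ((List.mem_singleton.1 h₁).trans (List.mem_singleton.1 h₂).symm)
    · obtain ⟨rs, hrs, hsuf⟩ := ih.runs _ hrun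
      have hev : e.2 ∈ rs.events := hsuf.subset List.mem_cons_self
      have hnew : IsRunOf S (α ++ [e]) e.1 rs := by
        obtain ⟨P, hP, r, hr⟩ := hrs.spec
        refine ⟨⟨P, hP, r, hr⟩, ?_, fun c hc => ?_⟩
        · obtain ⟨i, l, r, h, h', h''⟩ := hrs.created
          exact ⟨i, l, r, hsub h, h'.trans hrid.symm, h''⟩
        · rcases hσ c hc with hc | ⟨x, hx, hc⟩
          · exact hrs.typed c hc
          · exact (((hS.wf P hP).role_wf r rs hr).typed c).2 ⟨e.2, hev, x, hx, hc⟩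
      refine ⟨?_, ?_, ?_, ?_⟩
      · rw [hF]
        rintro run (⟨hrun, -⟩ | rfl)
        · exact hold run hrun
        · exact ⟨rs, hnew, (List.suffix_cons _ _).trans hsuf⟩
      · intro e' he'
        rcases List.mem_append.1 he' with he' | he'
        · obtain ⟨rs', h, h'⟩ := ih.events e' he'
          exact ⟨rs', h.mono hsub, h'⟩
        · obtain rfl := List.mem_singleton.1 he'
          exact ⟨rs, hnew, hev⟩
      · intro e' he'
        rw [hF]
        rcases List.mem_append.1 he' with he' | he'
        · obtain ⟨run, hrun', hr⟩ := ih.rids e' he'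
          obtain ⟨run', h, h'⟩ := exists_rid_replaceRun (new := (e.1, es))
            (old := (inst, e.2 :: es)) hrid hrun'
          exact ⟨run', h, h'.trans hr⟩
        · obtain rfl := List.mem_singleton.1 he'
          exact ⟨_, .inr rfl, rfl⟩
      · intro i i' l₁ r₁ l₂ r₂ h₁ h₂ hii
        rcases List.mem_append.1 h₁ with h₁ | h₁
        · rcases List.mem_append.1 h₂ with h₂ | h₂
          · exact ih.create_unique i i' _ _ _ _ h₁ h₂ hii
          · exact absurd (congrArg Prod.snd (List.mem_singleton.1 h₂)).symm (hne _ _)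
        · exact absurd (congrArg Prod.snd (List.mem_singleton.1 h₁)).symm (hne _ _)

theorem Execution.hasEvent {S : Set (Protocol M)} (hS : IsProtocolSet S) {α : Trace M}
    {st : State M} (h : Execution S α st) {e : RunEvent M} (he : e ∈ α) : HasEvent S e.2 :=
  let ⟨_, hrs, h'⟩ := (h.runsValid hS).events e he
  hrs.hasEvent h'

/-- Finitely many nonces are assigned to identifiers in an execution. -/
theorem Execution.finite_nonces {S : Set (Protocol M)} (hS : IsProtocolSet S) {α : Trace M}
    {st : State M} (h : Execution S α st) :
    {n | ∃ e ∈ α, ∃ c, e.1.σ c = some n}.Finite := by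
  have : {n | ∃ e ∈ α, ∃ c, e.1.σ c = some n} =
      ⋃ e ∈ {e | e ∈ α}, {n | ∃ c, e.1.σ c = some n} := by
    ext n
    simp
  rw [this]
  refine (List.finite_toSet α).biUnion fun e he => ?_
  obtain ⟨rs, hrs, -⟩ := (h.runsValid hS).events e he
  obtain ⟨P, hP, r, hr⟩ := hrs.spec
  -- A run assigns values only to typed identifiers, and these occur in the finitely many terms of
  -- its specification.
  have hfin := ((hS.wf P hP).role_wf r rs hr).finite_typed
  refine ((hfin.image e.1.σ).preimage (f := some) fun a _ b _ h => Option.some.inj h).subset ?_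
  rintro n ⟨c, hc⟩
  exact ⟨c, hrs.typed c (by rw [hc]; rfl), hc⟩

/-- The messages that have been sent. -/
def sentTerms (S : Set (Protocol M)) (α : Trace M) : Set (RunTerm M) :=
  {t | ∃ inst ev m ty, (inst, ev) ∈ α ∧ IsSend ev m ∧ IsTyping S ev ty ∧ inst.Eval ty m t}

theorem sentTerms_mono {S : Set (Protocol M)} {α β : Trace M} (h : α ⊆ β) :
    sentTerms S α ⊆ sentTerms S β :=
  fun _ ⟨i, ev, m, ty, he, h'⟩ => ⟨i, ev, m, ty, h he, h'⟩

/-- The successive closures are flattened into a single one over terms read off from the trace, so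
that an encryption can be traced back to a sent message. -/
theorem Execution.closure_of_mem {S : Set (Protocol M)} {α : Trace M} {st : State M}
    (h : Execution S α st) {t : RunTerm M} (ht : t ∈ st.IK) :
    Closure ({t | InitialTerm t} ∪ sentTerms S α) t := by
  induction h generalizing t with
  | nil => exact Closure.mono (fun t ht => .base (.inl ht)) ht
  | @snoc α st e st' _ hstep ih =>
    have hsub : α ⊆ α ++ [e] := List.subset_append_left _ _
    have hold : ∀ t ∈ st.IK, Closure ({t | InitialTerm t} ∪ sentTerms S (α ++ [e])) t :=
      fun t ht => Closure.mono
        (fun t ht => .base (ht.imp_right fun ht => sentTerms_mono hsub ht)) (ih ht)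
    cases hstep with
    | create | finish | read | claim => exact hold t ht
    | send hF hty hE =>
      refine Closure.mono ?_ ht
      rintro v (hv | rfl)
      · exact hold v hv
      · exact .base (.inr ⟨_, _, _, _, List.mem_append_right _ (List.mem_singleton_self _),
          ⟨_, _, _, rfl⟩, hty, hE⟩)

theorem Execution.mem_of_closure {S : Set (Protocol M)} {α : Trace M} {st : State M}
    (h : Execution S α st) {t : RunTerm M} (ht : Closure st.IK t) : t ∈ st.IK := by
  induction h generalizing t with
  | nil => exact Closure.mono (fun t ht => ht) ht
  | snoc _ hstep ih =>
    cases hstep with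
    | create | finish | read | claim => exact ih ht
    | send => exact Closure.mono (fun t ht => ht) ht

theorem Execution.initialTerm_mem {S : Set (Protocol M)} {α : Trace M} {st : State M}
    (h : Execution S α st) {t : RunTerm M} (ht : InitialTerm t) : t ∈ st.IK := by
  induction h with
  | nil => exact .base ht
  | snoc _ hstep ih =>
    cases hstep with
    | create | finish | read | claim => exact ih
    | send => exact .base (.inl ih)

/-! ### Restriction and renaming of traces -/

theorem Inst.rename_injective (s : Equiv.Perm (Nonce M)) :
    Function.Injective (Inst.rename (M := M) s) := by
  intro i j h
  simp only [Inst.rename, Inst.mk.injEq] at h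
  refine Inst.ext h.1 h.2.1 (funext fun c => ?_)
  exact Option.map_injective s.injective (congrFun h.2.2 c)

open Classical in
/-- The events of `S` in `α`, with the renaming `s` applied. -/
noncomputable def restrictTrace (S : Set (Protocol M)) (s : Equiv.Perm (Nonce M)) (α : Trace M) :
    Trace M :=
  (α.filter fun e => decide (HasLabel S e.2.label)).map fun e => (e.1.rename s, e.2)

theorem restrictTrace_snoc_of_hasLabel {S : Set (Protocol M)} {s : Equiv.Perm (Nonce M)}
    {α : Trace M} {e : RunEvent M} (h : HasLabel S e.2.label) :
    restrictTrace S s (α ++ [e]) = restrictTrace S s α ++ [(e.1.rename s, e.2)] := by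
  simp [restrictTrace, h]

theorem restrictTrace_snoc_of_not_hasLabel {S : Set (Protocol M)} {s : Equiv.Perm (Nonce M)}
    {α : Trace M} {e : RunEvent M} (h : ¬ HasLabel S e.2.label) :
    restrictTrace S s (α ++ [e]) = restrictTrace S s α := by
  simp [restrictTrace, h]

theorem mem_restrictTrace {S : Set (Protocol M)} {s : Equiv.Perm (Nonce M)} {α : Trace M}
    {e : RunEvent M} (h : HasLabel S e.2.label) (he : e ∈ α) :
    (e.1.rename s, e.2) ∈ restrictTrace S s α := by
  classical
  exact List.mem_map.2 ⟨e, List.mem_filter.2 ⟨he, decide_eq_true h⟩, rfl⟩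

theorem proj_restrictTrace {S : Set (Protocol M)} {P : Protocol M} (hP : P ∈ S)
    (s : Equiv.Perm (Nonce M)) (α : Trace M) :
    proj P (restrictTrace S s α) = (proj P α).map fun e => (e.1.rename s, e.2) := by
  classical
  rw [proj, proj, restrictTrace, List.filter_map, List.filter_filter]
  congr 1
  refine List.filter_congr fun e _ => ?_
  simp only [Function.comp_apply, ← Bool.decide_and]
  exact decide_eq_decide.2 ⟨fun h => h.1, fun h => ⟨h, P, hP, h⟩⟩

/-! ### Removing the events of a protocol set from a trace -/

theorem HasEvent.fnLongTerm {S : Set (Protocol M)} (hS : IsProtocolSet S) {ev : Event M}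
    (h : HasEvent S ev) {x : RoleTerm M} (hx : x ∈ ev.terms) : x.FnLongTerm :=
  let ⟨P, hP, r, rs, hr, he⟩ := h
  ((hS.wf P hP).role_wf r rs hr).fnLongTerm ev he x hx

theorem HasEvent.secretKeys {S : Set (Protocol M)} (hS : IsProtocolSet S) {ev : Event M}
    (h : HasEvent S ev) {x : RoleTerm M} (hx : IsSend ev x) : x.SecretKeysOnlyAsKeys :=
  let ⟨P, hP, r, rs, hr, he⟩ := h
  let ⟨l, r₁, r₂, hev⟩ := hx
  ((hS.wf P hP).role_wf r rs hr).secretKeys ev he x ⟨l, r₁, r₂, .inl hev⟩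

theorem IsSend.mem_terms {ev : Event M} {m : RoleTerm M} (h : IsSend ev m) : m ∈ ev.terms := by
  obtain ⟨l, r, r', rfl⟩ := h
  rfl

/-- In the trace `α`, no encryption sent by `S` coincides with an encryption of `S'`. -/
def EncSeparated (α : Trace M) (S S' : Set (Protocol M)) : Prop :=
  ∀ (inst inst' : Inst M) (ev ev' : Event M) (m m' x y x' y' : RoleTerm M)
    (ty ty' : M.Id → Option IdType) (t : RunTerm M),
    (inst, ev) ∈ α → (inst', ev') ∈ α → IsSend ev m → m' ∈ ev'.terms →
    IsTyping S ev ty → IsTyping S' ev' ty' →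
    RoleTerm.Subterm (.enc x y) m → RoleTerm.Subterm (.enc x' y') m' →
    inst.Eval ty (.enc x y) t → inst'.Eval ty' (.enc x' y') t → False

/-- The conditions on the trace `α` of `S₁ ∪ S₂` and the renaming `s` under which the restriction
of `α` to `S₁` is, up to `s`, a trace of `S₁`. The map `h` extends the action of `s` on the nonces
in `α` such that it makes all nonces intruder-generated that are no constants of runs of `S₁`. -/
structure Removable (S₁ S₂ : Set (Protocol M)) (α : Trace M) (s : Equiv.Perm (Nonce M))
    (h : Nonce M → Nonce M) : Prop where
  protocols : IsProtocolSet (S₁ ∪ S₂)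
  disjoint : Disjoint S₁ S₂
  const_left : ∀ inst ev ty c, (inst, ev) ∈ α → IsTyping S₁ ev ty → ty c = some .const →
    h (.fresh c inst.rid) = .fresh c inst.rid
  const_right : ∀ inst ev ty c, (inst, ev) ∈ α → IsTyping S₂ ev ty → ty c = some .const →
    h (.fresh c inst.rid) ∈ Set.range Nonce.intruder
  eq_perm : ∀ inst ev c n, (inst, ev) ∈ α → inst.σ c = some n → h n = s n
  intruder : ∀ a, h (.intruder a) ∈ Set.range Nonce.intruder
  input : ∀ β inst l r, β ++ [(inst, Event.create l r)] <+: α → HasEvent S₂ (.create l r) →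
    ∀ d n, inst.σ d = some n →
      h n ∈ Set.range Nonce.intruder ∨ .nonce n ∈ knowledge (S₁ ∪ S₂) β
  separated : EncSeparated α S₁ S₂
  separated' : EncSeparated α S₂ S₁

/-- The encryptions in the content of messages sent by `S`. -/
def sentEncs (S : Set (Protocol M)) (α : Trace M) : Set (RunTerm M) :=
  {u | ∃ t ∈ sentTerms S α, ∃ a b, u = .enc a b ∧ u.Content t}

/-- The active runs of `S` in `F` are renamed runs of `F'`, whose run identifiers all come from
`F`. -/
structure RunsMatch (S : Set (Protocol M)) (s : Equiv.Perm (Nonce M)) (F F' : Set (Run M)) :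
    Prop where
  mem : ∀ inst ev es, (inst, ev :: es) ∈ F → HasEvent S ev → (inst.rename s, ev :: es) ∈ F'
  rids : ∀ run' ∈ F', ∃ run ∈ F, run.1.rid = run'.1.rid

/-- The state `st'`, reached with the restriction of `β` to `S₁`, simulates the state `st`, reached
with `β`. -/
structure Simulates (S₁ S₂ : Set (Protocol M)) (s : Equiv.Perm (Nonce M)) (h : Nonce M → Nonce M)
    (β : Trace M) (st st' : State M) : Prop where
  exec : Execution S₁ (restrictTrace S₁ s β) st'
  runs_left : RunsMatch S₁ s st.F st'.F
  sent : ∀ inst ev m ty t, (inst, ev) ∈ β → IsSend ev m → IsTyping S₁ ev ty →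
    (inst.rename s).Eval ty m t → t ∈ st'.IK
  runs_right : ∀ inst ev es, (inst, ev :: es) ∈ st.F → HasEvent S₂ ev →
    ∀ c n, inst.σ c = some n → .nonce (h n) ∈ st'.IK
  events_right : ∀ inst ev, (inst, ev) ∈ β → HasEvent S₂ ev →
    ∀ c n, inst.σ c = some n → .nonce (h n) ∈ st'.IK

section Simulates

variable {S₁ S₂ : Set (Protocol M)} {α β : Trace M} {s : Equiv.Perm (Nonce M)}
  {h : Nonce M → Nonce M} {st st' : State M}

theorem Simulates.intruder_mem (hs : Simulates S₁ S₂ s h β st st') {n : Nonce M}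
    (hn : n ∈ Set.range Nonce.intruder) : .nonce n ∈ st'.IK := by
  obtain ⟨a, rfl⟩ := hn
  exact hs.exec.initialTerm_mem (.intruder a)

theorem Simulates.noncesIn (hs : Simulates S₁ S₂ s h β st st') (hα : Removable S₁ S₂ α s h)
    (hβ : β ⊆ α) {inst : Inst M} {ev : Event M} {ty : M.Id → Option IdType} (he : (inst, ev) ∈ β)
    (hty : IsTyping S₂ ev ty) : inst.NoncesIn ty {n | .nonce (h n) ∈ st'.IK} :=
  ⟨fun c hc => hs.intruder_mem (hα.const_right inst ev ty c (hβ he) hty hc),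
    hs.events_right inst ev he hty.hasEvent⟩

/-- The messages of `S₁` are only renamed. -/
theorem Removable.eval_rename (hα : Removable S₁ S₂ α s h) (hβ : β ⊆ α) (d : RunTerm M)
    {inst : Inst M} {ev : Event M} {ty : M.Id → Option IdType} {m : RoleTerm M} {t : RunTerm M}
    (he : (inst, ev) ∈ α) (hty : IsTyping S₁ ev ty) (hm : m ∈ ev.terms) (ht : inst.Eval ty m t) :
    (inst.rename s).Eval ty m (replaceEnc h (sentEncs S₂ β) d t) := by
  refine ht.rename
    (hty.hasEvent.fnLongTerm (hα.protocols.mono Set.subset_union_left) hm)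
    (fun c hc => hα.const_left inst ev ty c he hty hc)
    (fun c n hn => hα.eq_perm inst ev c n he hn) ?_
  rintro y z _ hsub hu ⟨t₀, ⟨inst₀, ev₀, m₀, ty₀, he₀, hm₀, hty₀, ht₀⟩, a, b, rfl, hc⟩
  -- A replaced encryption is an instance of an encryption in a send event of `S₂`; occurring in `m`
  -- it would violate independence.
  obtain ⟨w, hw, hwe, -⟩ := ht₀.exists_of_content hc
  cases hwe with
  | enc hx hy =>
    exact hα.separated' inst₀ inst ev₀ ev m₀ m _ _ _ _ ty₀ ty _ (hβ he₀) he hm₀ hm hty₀ hty hw hsub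
      (.enc hx hy) hu

theorem sentTerms_union {t : RunTerm M}
    (ht : t ∈ sentTerms (S₁ ∪ S₂) β) : t ∈ sentTerms S₁ β ∨ t ∈ sentTerms S₂ β := by
  obtain ⟨inst, ev, m, ty, he, hm, ⟨P, hP | hP, h⟩, ht⟩ := ht
  · exact .inl ⟨inst, ev, m, ty, he, hm, ⟨P, hP, h⟩, ht⟩
  · exact .inr ⟨inst, ev, m, ty, he, hm, ⟨P, hP, h⟩, ht⟩

/-- The intruder knowledge in a trace of `S₁ ∪ S₂` is mapped into the knowledge in the restriction
of the trace to `S₁`. -/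
theorem Simulates.replaceEnc_mem (hs : Simulates S₁ S₂ s h β st st')
    (hα : Removable S₁ S₂ α s h) (hβ : β ⊆ α) (a₀ : M.IT) {t : RunTerm M}
    (ht : Closure ({t | InitialTerm t} ∪ sentTerms (S₁ ∪ S₂) β) t) :
    replaceEnc h (sentEncs S₂ β) (.nonce (.intruder a₀)) t ∈ st'.IK := by
  have hS₂ := hα.protocols.mono Set.subset_union_right
  have hinit := fun t ht => hs.exec.initialTerm_mem (t := t) ht
  have hcl := fun t ht => hs.exec.mem_of_closure (t := t) ht
  have hd := hinit _ (.intruder a₀)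
  refine replaceEnc_mem_of_closure hcl hd rfl ?_ ?_ ht
  · rintro t (ht | ht)
    · cases ht with
      | agent a => exact hinit _ (.agent a)
      | intruder a => exact hs.intruder_mem (hα.intruder a)
      | pub args hf => exact hinit _ (.pub args hf)
      | compromised args hf => exact hinit _ (.compromised args hf)
    · rcases sentTerms_union ht with
        ⟨inst, ev, m, ty, he, hm, hty, ht⟩ | ht
      · exact hs.sent inst ev m ty _ he hm hty
          (hα.eval_rename hβ _ (hβ he) hty hm.mem_terms ht)
      · obtain ⟨inst, ev, m, ty, he, hm, hty, hE⟩ := ht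
        exact hE.replaceEnc_mem (hty.hasEvent.secretKeys hS₂ hm) hinit hcl hd
          (hs.noncesIn hα hβ he hty) fun a b hc =>
            ⟨t, ⟨inst, ev, m, ty, he, hm, hty, hE⟩, a, b, rfl, hc⟩
  -- The body of a replaced encryption is content of a message of `S₂`: it has secret keys only as
  -- keys, and the encryptions in its content are replaced as well.
  · rintro t v ⟨t₀, ⟨inst, ev, m, ty, he, hm, hty, hE⟩, a, b, -, hc⟩
    obtain ⟨w, -, hwe, hw⟩ := hE.exists_of_content hc
    cases hwe with
    | enc hx _ =>
      exact hx.replaceEnc_mem (hw (hty.hasEvent.secretKeys hS₂ hm)) hinit hcl hd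
        (hs.noncesIn hα hβ he hty) fun a b hab =>
          ⟨t₀, ⟨inst, ev, m, ty, he, hm, hty, hE⟩, a, b, rfl, (RunTerm.Content.enc hab).trans hc⟩

/-- The nonces that `S₂` learns from a message are known to the intruder. -/
theorem Simulates.nonce_mem_of_read (hs : Simulates S₁ S₂ s h β st st')
    (hα : Removable S₁ S₂ α s h) (hβ : β ⊆ α) (a₀ : M.IT) {inst : Inst M} {ev : Event M}
    {ty : M.Id → Option IdType} {m x : RoleTerm M} {t : RunTerm M} (he : (inst, ev) ∈ α)
    (hty : IsTyping S₂ ev ty) (hm : m ∈ ev.terms) (hE : inst.Eval ty x t) (hx : x.Subterm m)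
    (ht : Closure ({t | InitialTerm t} ∪ sentTerms (S₁ ∪ S₂) β) t) {n : Nonce M}
    (hn : n ∈ t.nonces) : .nonce (h n) ∈ st'.IK := by
  have hnonce : ∀ n', Closure ({t | InitialTerm t} ∪ sentTerms (S₁ ∪ S₂) β) (.nonce n') →
      n ∈ ({n'} : Set (Nonce M)) → .nonce (h n) ∈ st'.IK := by
    rintro n' ht' rfl
    exact hs.replaceEnc_mem hα hβ a₀ ht'
  induction hE with
  | role => exact absurd hn (Set.notMem_empty _)
  | const => exact hnonce _ ht hn
  | var => exact hnonce _ ht hn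
  | param => exact hnonce _ ht hn
  | fn => exact absurd hn (Set.notMem_empty _)
  | pair _ _ ih ih' =>
    exact hn.elim (ih (.trans (.pair_left (.refl _)) hx) (.fst ht))
      (ih' (.trans (.pair_right (.refl _)) hx) (.snd ht))
  | enc hE hE' ih ih' =>
    -- If the intruder built the encryption, body and key are known and the induction applies.
    -- Otherwise it lies in the content of a sent message.
    rcases ht.enc_origin (.refl _) with ⟨h₁, h₂⟩ | ⟨k, hk | hk, hc⟩
    · exact hn.elim (ih (.trans (.enc_left (.refl _)) hx) h₁)
        (ih' (.trans (.enc_right (.refl _)) hx) h₂)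
    · exact absurd hc (InitialTerm.not_content_enc hk)
    · rcases sentTerms_union hk with
        ⟨inst₀, ev₀, m₀, ty₀, he₀, hm₀, hty₀, hE₀⟩ | ⟨inst₀, ev₀, m₀, ty₀, he₀, hm₀, hty₀, hE₀⟩
      -- An encryption sent by `S₁` and read by `S₂` contradicts independence.
      · obtain ⟨w, hw, hwe, -⟩ := hE₀.exists_of_content hc
        cases hwe with
        | enc h₁ h₂ =>
          exact (hα.separated inst₀ inst ev₀ ev m₀ m _ _ _ _ ty₀ ty _ (hβ he₀) he hm₀ hm hty₀ hty
            hw hx (.enc h₁ h₂) (.enc hE hE')).elim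
      -- `S₂` sent it: the intruder may be unable to open it, but the invariant covers all nonces of
      -- the sending run.
      · obtain ⟨w, hw, hwe, -⟩ := hE₀.exists_of_content hc
        exact hwe.nonces_subset (hs.noncesIn hα hβ he₀ hty₀) hn

end Simulates

/-! ### Simulation of the steps -/

section Steps

variable {S₁ S₂ : Set (Protocol M)} {α β : Trace M} {s : Equiv.Perm (Nonce M)}
  {h : Nonce M → Nonce M} {st st₁ st' : State M} {e : RunEvent M}

theorem RunsMatch.advance {S : Set (Protocol M)} {F F' : Set (Run M)} (hF : RunsMatch S s F F')
    {inst inst' : Inst M} {ev : Event M} {es : List (Event M)} (hev : HasEvent S ev)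
    (hrun : (inst, ev :: es) ∈ F) (hrid : inst'.rid = inst.rid) :
    RunsMatch S s (replaceRun F (inst', es) (inst, ev :: es))
      (replaceRun F' (inst'.rename s, es) (inst.rename s, ev :: es)) := by
  refine ⟨fun i a as hi ha => ?_, fun run' hrun' => ?_⟩
  · rcases mem_replaceRun.1 hi with ⟨hi, hne⟩ | hi
    · refine .inl ⟨hF.mem i a as hi ha, fun heq => hne ?_⟩
      obtain ⟨h₁, h₂⟩ := Prod.mk.inj heq
      rw [Inst.rename_injective s h₁, h₂]
    · obtain ⟨rfl, rfl⟩ := Prod.mk.inj hi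
      exact .inr rfl
  · obtain ⟨run₁, h₁, h₁'⟩ := exists_rid_of_replaceRun (hF.mem _ _ _ hrun hev) hrid hrun'
    obtain ⟨run₂, h₂, h₂'⟩ := hF.rids run₁ h₁
    obtain ⟨run₃, h₃, h₃'⟩ := exists_rid_replaceRun (new := (inst', es))
      (old := (inst, ev :: es)) hrid h₂
    exact ⟨run₃, h₃, h₃'.trans (h₂'.trans h₁')⟩

theorem RunsMatch.create {S : Set (Protocol M)} {F F' : Set (Run M)} (hF : RunsMatch S s F F')
    (inst : Inst M) (es : List (Event M)) :
    RunsMatch S s (F ∪ {(inst, es)}) (F' ∪ {(inst.rename s, es)}) := by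
  refine ⟨fun i a as hi ha => ?_, fun run' hrun' => ?_⟩
  · rcases hi with hi | hi
    · exact .inl (hF.mem i a as hi ha)
    · obtain ⟨rfl, rfl⟩ := Prod.mk.inj hi
      exact .inr rfl
  · rcases hrun' with hrun' | rfl
    · obtain ⟨run, h, h'⟩ := hF.rids run' hrun'
      exact ⟨run, .inl h, h'⟩
    · exact ⟨_, .inr rfl, rfl⟩

/-- In a step, at most one run is added or advanced; its events belong to the same protocol as the
executed event. -/
theorem Step.frame {S : Set (Protocol M)} (hS : IsProtocolSet S) (hv : RunsValid S β st)
    (hstep : Step S st e st₁) :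
    ∃ es, (∀ T ⊆ S, HasEvent T e.2 → ∀ ev ∈ es, HasEvent T ev) ∧
      (∀ run ∈ st₁.F, run ∈ st.F ∨ run = (e.1, es)) ∧
      ∀ run ∈ st.F, ∃ run' ∈ st₁.F, run'.1.rid = run.1.rid := by
  have key : ∀ P ∈ S, ∀ r rs, P r = some rs → e.2 ∈ rs.events → ∀ T ⊆ S, HasEvent T e.2 →
      ∀ ev ∈ rs.events, HasEvent T ev := by
    rintro P hP r rs hr he T hT ⟨Q, hQ, he'⟩ ev hev
    obtain rfl := hS.eq_of_label hP (hT hQ) ⟨r, rs, hr, he⟩ he' rfl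
    exact ⟨P, hQ, r, rs, hr, hev⟩
  rcases hstep.create_or_advance with
    ⟨l, r, es, he, ⟨P, hP, r', rs, hr, hes, -⟩, -, hF⟩ | ⟨inst, es, -, hrun, hrid, hF, -⟩
  · have hes : .create l r :: es = rs.events := hes
    refine ⟨es, fun T hT hev ev hmem => key P hP r' rs hr ?_ T hT hev ev ?_, ?_, ?_⟩
    · rw [he, ← hes]
      exact List.mem_cons_self
    · rw [← hes]
      exact List.mem_cons_of_mem _ hmem
    · rw [hF]
      exact fun run h => h
    · rw [hF]
      exact fun run h => ⟨run, .inl h, rfl⟩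
  · obtain ⟨rs, hrs, hsuf⟩ := hv.runs _ hrun
    obtain ⟨P, hP, r, hr⟩ := hrs.spec
    refine ⟨es, fun T hT hev ev hmem => key P hP r rs hr ?_ T hT hev ev ?_, ?_, ?_⟩
    · exact hsuf.subset List.mem_cons_self
    · exact hsuf.subset (List.mem_cons_of_mem _ hmem)
    · rw [hF]
      exact fun run h => (mem_replaceRun.1 h).imp_left And.left
    · rw [hF]
      exact fun run h => exists_rid_replaceRun hrid h

/-- A step of `S₁` is possible in the simulating state. -/
theorem Simulates.step_left (hs : Simulates S₁ S₂ s h β st st') (hα : Removable S₁ S₂ α s h)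
    (hex : Execution (S₁ ∪ S₂) β st) (a₀ : M.IT) (hstep : Step (S₁ ∪ S₂) st e st₁)
    (hβ : β ⊆ α) (he : e ∈ α) (hev : HasEvent S₁ e.2) :
    ∃ st₁', Step S₁ st' (e.1.rename s, e.2) st₁' ∧ st'.IK ⊆ st₁'.IK ∧
      RunsMatch S₁ s st₁.F st₁'.F ∧
      ∀ m ty t, IsSend e.2 m → IsTyping S₁ e.2 ty → (e.1.rename s).Eval ty m t → t ∈ st₁'.IK := by
  have hsub : S₁ ⊆ S₁ ∪ S₂ := Set.subset_union_left
  have hR := hs.runs_left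
  obtain ⟨IK', F'⟩ := st'
  cases hstep with
  | @create _ _ inst l r es hi hfresh =>
    refine ⟨_, .create (es := es) ?_ ?_, subset_rfl, hR.create _ _, fun m ty t hm => ?_⟩
    · obtain ⟨P, hP, r', rs, hr, hes, hρ, hσ⟩ := hi
      have hmem : Event.create l r ∈ rs.events := hes ▸ List.mem_cons_self
      obtain ⟨Q, hQ, hev⟩ := hev
      obtain rfl := hα.protocols.eq_of_label hP (hsub hQ) ⟨r', rs, hr, hmem⟩ hev rfl
      exact ⟨P, hQ, r', rs, hr, hes, hρ, fun c => by simpa [Inst.rename] using hσ c⟩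
    -- Every identifier in use on the restricted side is in use in the full state, so freshness is
    -- preserved.
    · intro run' hrun'
      obtain ⟨run, hrun, hrid⟩ := hR.rids run' hrun'
      rw [← hrid]
      exact hfresh run hrun
    · obtain ⟨_, _, _, h⟩ := hm
      cases h
  | finish hF =>
    refine ⟨_, .finish (hR.mem _ _ _ hF hev), subset_rfl, hR.advance hev hF rfl,
      fun m ty t hm => ?_⟩
    obtain ⟨_, _, _, h⟩ := hm
    cases h
  | send hF hty hE =>
    have hty' := hty.of_hasEvent hα.protocols hsub hev
    have hE' := hα.eval_rename hβ (.nonce (.intruder a₀)) he hty' rfl hE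
    refine ⟨_, .send (hR.mem _ _ _ hF hev) hty' hE', fun t ht => .base (.inl ht),
      hR.advance hev hF rfl, fun m ty₁ t hm hty₁ ht => ?_⟩
    obtain ⟨_, _, _, h⟩ := hm
    obtain ⟨-, -, -, rfl⟩ := Event.send.inj h
    obtain rfl := (hα.protocols.mono hsub).typing_unique hty' hty₁
    obtain rfl := hE'.unique ht
    exact .base (.inr rfl)
  | @read _ _ inst inst' l r r' m es ty t hF ht hty hmatch =>
    have hty' := hty.of_hasEvent hα.protocols hsub hev
    -- The image of the message under `replaceEnc` is both the renamed instance of the pattern and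
    -- known to the intruder.
    have hE' := hα.eval_rename hβ (.nonce (.intruder a₀)) he hty' rfl hmatch.2.2.2.2
    have ht' := hs.replaceEnc_mem hα hβ a₀ (hex.closure_of_mem ht)
    refine ⟨_, .read (hR.mem _ _ _ hF hev) ht' hty'
      ⟨hmatch.1, hmatch.2.1, fun c n hn => ?_, fun c => ?_, hE'⟩, subset_rfl,
      hR.advance hev hF hmatch.1, fun m ty t hm => ?_⟩
    · obtain ⟨k, hk, rfl⟩ := Option.map_eq_some_iff.1 hn
      exact Option.map_eq_some_iff.2 ⟨k, hmatch.2.2.1 c k hk, rfl⟩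
    · simpa [Inst.rename] using hmatch.2.2.2.1 c
    · obtain ⟨_, _, _, h⟩ := hm
      cases h
  | claim hF =>
    refine ⟨_, .claim (hR.mem _ _ _ hF hev), subset_rfl, hR.advance hev hF rfl,
      fun m ty t hm => ?_⟩
    obtain ⟨_, _, _, h⟩ := hm
    cases h

/-- In a step of `S₂`, the nonces of the instantiation are known to the intruder. -/
theorem Simulates.nonce_mem_of_step (hs : Simulates S₁ S₂ s h β st st')
    (hα : Removable S₁ S₂ α s h) (hex : Execution (S₁ ∪ S₂) β st) (a₀ : M.IT)
    (hstep : Step (S₁ ∪ S₂) st e st₁) (hβ : β ++ [e] <+: α) (hev : HasEvent S₂ e.2)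
    {c : M.Id} {n : Nonce M} (hn : e.1.σ c = some n) : .nonce (h n) ∈ st'.IK := by
  have hsub : S₂ ⊆ S₁ ∪ S₂ := Set.subset_union_right
  have hβ' : β ⊆ α := fun a ha => hβ.subset (List.mem_append_left _ ha)
  have he : e ∈ α := hβ.subset (List.mem_append_right _ (List.mem_singleton_self _))
  cases hstep with
  | create =>
    -- The absence of secret input is needed here: at creation the values are those of the
    -- parameters.
    rcases hα.input β _ _ _ hβ hev c n hn with hn | ⟨st₂, hex₂, hn⟩
    · exact hs.intruder_mem hn
    · exact hs.replaceEnc_mem hα hβ' a₀ (hex₂.closure_of_mem hn)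
  | finish hF => exact hs.runs_right _ _ _ hF hev c n hn
  | send hF => exact hs.runs_right _ _ _ hF hev c n hn
  | @read _ _ inst inst' l r r' m es ty t hF ht hty hmatch =>
    have hty' := hty.of_hasEvent hα.protocols hsub hev
    -- Values bound before are covered by the invariant; only variables bound by this pattern come
    -- from the message.
    rcases (hmatch.2.2.2.1 c).1 (by rw [hn]; rfl) with hc | ⟨hc, hvar⟩
    · obtain ⟨k, hk⟩ := Option.isSome_iff_exists.1 hc
      obtain rfl := Option.some.inj ((hmatch.2.2.1 c k hk).symm.trans hn)
      exact hs.runs_right _ _ _ hF hev c k hk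
    · have hE := hmatch.2.2.2.2
      exact hs.nonce_mem_of_read hα hβ' a₀ he hty' rfl hE (.refl _) (hex.closure_of_mem ht)
        (hE.mem_nonces (hev.fnLongTerm (hα.protocols.mono hsub) rfl) hc hvar hn)
  | claim hF => exact hs.runs_right _ _ _ hF hev c n hn

/-- A step of `S₁` is imitated, while a step of `S₂` leaves the simulating state unchanged and only
has to keep its nonces known. The remaining events of a run stay on the side of the executed one. -/
theorem Simulates.snoc (hs : Simulates S₁ S₂ s h β st st') (hα : Removable S₁ S₂ α s h)
    (hex : Execution (S₁ ∪ S₂) β st) (a₀ : M.IT) (hstep : Step (S₁ ∪ S₂) st e st₁)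
    (hβ : β ++ [e] <+: α) : ∃ st₁', Simulates S₁ S₂ s h (β ++ [e]) st₁ st₁' := by
  have hβ' : β ⊆ α := fun a ha => hβ.subset (List.mem_append_left _ ha)
  have he : e ∈ α := hβ.subset (List.mem_append_right _ (List.mem_singleton_self _))
  have hev := (hex.snoc hstep).hasEvent hα.protocols
    (List.mem_append_right _ (List.mem_singleton_self e))
  have hdisj : ∀ {ev}, HasEvent S₁ ev → HasEvent S₂ ev → False :=
    not_hasEvent_of_disjoint hα.protocols hα.disjoint rfl
  obtain ⟨es, hes, hnew, hold⟩ := hstep.frame hα.protocols (hex.runsValid hα.protocols)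
  have hes₁ := hes S₁ Set.subset_union_left
  have hes₂ := hes S₂ Set.subset_union_right
  by_cases h₁ : HasEvent S₁ e.2
  · obtain ⟨st₁', hstep', hIK, hR, hsent⟩ := hs.step_left hα hex a₀ hstep hβ' he h₁
    refine ⟨st₁', ?_, hR, ?_, ?_, ?_⟩
    · rw [restrictTrace_snoc_of_hasLabel h₁.hasLabel]
      exact hs.exec.snoc hstep'
    · intro inst ev m ty t hmem hm hty ht
      rcases List.mem_append.1 hmem with hmem | hmem
      · exact hIK (hs.sent inst ev m ty t hmem hm hty ht)
      · obtain rfl := List.mem_singleton.1 hmem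
        exact hsent m ty t hm hty ht
    · intro inst ev evs hrun h₂ c n hn
      rcases hnew _ hrun with hrun | hrun
      · exact hIK (hs.runs_right inst ev evs hrun h₂ c n hn)
      · obtain ⟨rfl, rfl⟩ := Prod.mk.inj hrun
        exact (hdisj (hes₁ h₁ ev List.mem_cons_self) h₂).elim
    · intro inst ev hmem h₂ c n hn
      rcases List.mem_append.1 hmem with hmem | hmem
      · exact hIK (hs.events_right inst ev hmem h₂ c n hn)
      · obtain rfl := List.mem_singleton.1 hmem
        exact (hdisj h₁ h₂).elim
  · have h₂ : HasEvent S₂ e.2 := by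
      obtain ⟨P, hP | hP, hev⟩ := hev
      · exact absurd ⟨P, hP, hev⟩ h₁
      · exact ⟨P, hP, hev⟩
    have hknown := fun c n => hs.nonce_mem_of_step hα hex a₀ hstep hβ h₂ (c := c) (n := n)
    refine ⟨st', ?_, ⟨?_, ?_⟩, ?_, ?_, ?_⟩
    · rw [restrictTrace_snoc_of_not_hasLabel fun hl =>
        h₁ (hev.of_label hα.protocols Set.subset_union_left hl)]
      exact hs.exec
    · intro inst ev evs hrun hev₁
      rcases hnew _ hrun with hrun | hrun
      · exact hs.runs_left.mem inst ev evs hrun hev₁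
      · obtain ⟨rfl, rfl⟩ := Prod.mk.inj hrun
        exact (hdisj hev₁ (hes₂ h₂ ev List.mem_cons_self)).elim
    · intro run' hrun'
      obtain ⟨run, hrun, hrid⟩ := hs.runs_left.rids run' hrun'
      obtain ⟨run₁, hrun₁, hrid₁⟩ := hold run hrun
      exact ⟨run₁, hrun₁, hrid₁.trans hrid⟩
    · intro inst ev m ty t hmem hm hty ht
      rcases List.mem_append.1 hmem with hmem | hmem
      · exact hs.sent inst ev m ty t hmem hm hty ht
      · obtain rfl := List.mem_singleton.1 hmem
        exact (h₁ hty.hasEvent).elim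
    · intro inst ev evs hrun hev₂ c n hn
      rcases hnew _ hrun with hrun | hrun
      · exact hs.runs_right inst ev evs hrun hev₂ c n hn
      · obtain ⟨rfl, rfl⟩ := Prod.mk.inj hrun
        exact hknown c n hn
    · intro inst ev hmem hev₂ c n hn
      rcases List.mem_append.1 hmem with hmem | hmem
      · exact hs.events_right inst ev hmem hev₂ c n hn
      · obtain rfl := List.mem_singleton.1 hmem
        exact hknown c n hn

/-- The restriction to `S₁` of a trace of `S₁ ∪ S₂` is a trace of `S₁` after renaming. -/
theorem Removable.restrictTrace_mem (hα : Removable S₁ S₂ α s h) (a₀ : M.IT)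
    (hex : Execution (S₁ ∪ S₂) α st) : restrictTrace S₁ s α ∈ Tr S₁ := by
  -- The induction is over prefixes of a fixed `α`, because separation is available for `α` only: a
  -- trace restriction need not pass to prefixes.
  suffices H : ∀ β st, Execution (S₁ ∪ S₂) β st → β <+: α →
      ∃ st', Simulates S₁ S₂ s h β st st' by
    obtain ⟨st', hs⟩ := H α st hex (List.prefix_refl α)
    exact ⟨st', hs.exec⟩
  intro β st hβ
  induction hβ with
  | nil =>
    intro _
    refine ⟨initialState, ?_, ⟨?_, ?_⟩, ?_, ?_, ?_⟩
    · exact .nil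
    · exact fun _ _ _ h => absurd h (Set.notMem_empty _)
    · exact fun _ h => absurd h (Set.notMem_empty _)
    · exact fun _ _ _ _ _ h => absurd h List.not_mem_nil
    · exact fun _ _ _ h => absurd h (Set.notMem_empty _)
    · exact fun _ _ h => absurd h List.not_mem_nil
  | snoc hex hstep ih =>
    intro hpre
    obtain ⟨st', hs⟩ := ih ((List.prefix_append _ _).trans hpre)
    exact hs.snoc hα hex a₀ hstep hpre

end Steps

/-! ### Independent protocol sets -/

section Independent

variable {S₁ S₂ : Set (Protocol M)} {α : Trace M}

theorem RunsValid.exists_create {S T : Set (Protocol M)} (hS : IsProtocolSet S) (hT : T ⊆ S)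
    {st : State M} (hv : RunsValid S α st) {inst : Inst M} {ev : Event M}
    {ty : M.Id → Option IdType} (he : (inst, ev) ∈ α) (hty : IsTyping T ev ty) :
    ∃ inst₀ l r, (inst₀, Event.create l r) ∈ α ∧ inst₀.rid = inst.rid ∧
      IsTyping T (.create l r) ty := by
  obtain ⟨rs, hrs, hev⟩ := hv.events _ he
  obtain ⟨inst₀, l, r, h₀, hrid, hmem⟩ := hrs.created
  obtain ⟨P, hP, r', hr'⟩ := hrs.spec
  obtain ⟨Q, hQ, r'', rs'', hr'', hev'', rfl⟩ := hty
  obtain ⟨rfl, rfl⟩ := hS.spec_unique hP (hT hQ) hr' hr'' hev hev''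
  exact ⟨inst₀, l, r, h₀, hrid, P, hQ, r'', rs, hr'', hmem, rfl⟩

/-- Independence puts both labels on one side, the typings put them on different sides, and disjoint
parts of a protocol set share no label. -/
theorem IndependentIn.encSeparated {χ : Trace M → Prop} (hS : IsProtocolSet (S₁ ∪ S₂))
    (hind : IndependentIn χ S₁ S₂) (hα : α ∈ Tr (S₁ ∪ S₂)) (hχ : χ α) :
    EncSeparated α S₁ S₂ ∧ EncSeparated α S₂ S₁ := by
  constructor
  · intro inst inst' ev ev' m m' x y x' y' ty ty' t he he' hm hm' hty hty' hx hx' hE hE'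
    rcases hind.2 α hα hχ inst inst' ev ev' m m' x y x' y' ty ty' t he he' hm hm'
      (hty.mono Set.subset_union_left) (hty'.mono Set.subset_union_right) hx hx' hE hE' with h | h
    · exact not_hasLabel_of_disjoint hS hind.1 h.2 hty'.hasEvent.hasLabel
    · exact not_hasLabel_of_disjoint hS hind.1 hty.hasEvent.hasLabel h.1
  · intro inst inst' ev ev' m m' x y x' y' ty ty' t he he' hm hm' hty hty' hx hx' hE hE'
    rcases hind.2 α hα hχ inst inst' ev ev' m m' x y x' y' ty ty' t he he' hm hm'
      (hty.mono Set.subset_union_right) (hty'.mono Set.subset_union_left) hx hx' hE hE' with h | h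
    · exact not_hasLabel_of_disjoint hS hind.1 h.1 hty.hasEvent.hasLabel
    · exact not_hasLabel_of_disjoint hS hind.1 hty'.hasEvent.hasLabel h.2

/-- In the absence of secret input from `S₁` to `S₂`, a trace without common encryptions of `S₁` and
`S₂` can be restricted to `S₁`. -/
theorem exists_removable [Infinite M.IT] (hS : IsProtocolSet (S₁ ∪ S₂)) (hd : Disjoint S₁ S₂)
    {st : State M} (hex : Execution (S₁ ∪ S₂) α st) (hin : NoSecretInput S₁ S₂ α)
    (hsep : EncSeparated α S₁ S₂) (hsep' : EncSeparated α S₂ S₁) :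
    ∃ s h, Removable S₁ S₂ α s h ∧ ∀ inst ev ty, (inst, ev) ∈ α → IsTyping S₁ ev ty →
      RespectsConstants s ty inst := by
  classical
  obtain ⟨a₀⟩ : Nonempty M.IT := inferInstance
  have hv := hex.runsValid hS
  let C : Set (Nonce M) := {n | ∃ c rid, n = .fresh c rid ∧ IsConstantOf S₁ α c rid}
  obtain ⟨s, hsC, hsU⟩ := exists_perm_intruder C
    (by rintro a ⟨c, rid, h, -⟩; cases h) (hex.finite_nonces hS)
  -- `h` must act on every nonce the intruder may know, also on those that are no values of
  -- identifiers. The default `a₀` is used only for such nonces, where agreement with `s` is not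
  -- required.
  let h : Nonce M → Nonce M := fun n =>
    if n ∈ C then n else if s n ∈ Set.range Nonce.intruder then s n else .intruder a₀
  have hC : ∀ n ∈ C, h n = n := fun n hn => if_pos hn
  have hnC : ∀ n, n ∉ C → h n ∈ Set.range Nonce.intruder := by
    intro n hn
    by_cases hs : s n ∈ Set.range Nonce.intruder
    · rw [show h n = s n from (if_neg hn).trans (if_pos hs)]
      exact hs
    · exact ⟨a₀, ((if_neg hn).trans (if_neg hs)).symm⟩
  have hfresh : ∀ c rid, .fresh c rid ∈ C → IsConstantOf S₁ α c rid := by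
    rintro c rid ⟨c', rid', heq, hc⟩
    obtain ⟨rfl, rfl⟩ := Nonce.fresh.inj heq
    exact hc
  have hintr : ∀ a, h (.intruder a) ∈ Set.range Nonce.intruder := by
    refine fun a => hnC _ ?_
    rintro ⟨c, rid, h, -⟩
    cases h
  have hleft : ∀ inst ev ty c, (inst, ev) ∈ α → IsTyping S₁ ev ty → ty c = some .const →
      .fresh c inst.rid ∈ C := by
    intro inst ev ty c he hty hc
    obtain ⟨inst₀, l, r, h₀, hrid, hty₀⟩ := hv.exists_create hS Set.subset_union_left he hty
    exact ⟨c, inst.rid, rfl, inst₀, l, r, ty, h₀, hrid, hty₀, hc⟩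
  refine ⟨s, h, ⟨hS, hd, fun inst ev ty c he hty hc => hC _ (hleft inst ev ty c he hty hc),
    fun inst ev ty c he hty hc => hnC _ fun hmem => ?_, fun inst ev c n he hn => ?_, hintr,
    fun β inst l r hβ hev d n hn => ?_, hsep, hsep'⟩,
    fun inst ev ty he hty c hc => hsC _ (hleft inst ev ty c he hty hc)⟩
  -- A constant of both an `S₁`-run and an `S₂`-run would give one run identifier create events from
  -- both sides.
  · obtain ⟨inst₁, l₁, r₁, ty₁, h₁, hrid₁, hty₁, -⟩ := hfresh _ _ hmem
    obtain ⟨inst₀, l, r, h₀, hrid, hty₀⟩ := hv.exists_create hS Set.subset_union_right he hty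
    have heq := hv.create_unique _ _ _ _ _ _ h₁ h₀ (hrid₁.trans hrid.symm)
    exact not_hasEvent_of_disjoint hS hd (congrArg Event.label heq) hty₁.hasEvent hty₀.hasEvent
  · by_cases hnmem : n ∈ C
    · rw [hC n hnmem, hsC n hnmem]
    · exact (if_neg hnmem).trans (if_pos (hsU n ⟨_, he, c, hn⟩ hnmem))
  · cases n with
    | intruder a => exact .inl (hintr a)
    | fresh c rid =>
      by_cases hmem : .fresh c rid ∈ C
      · obtain ⟨γ, rfl⟩ := hβ
        have := hin β.length inst l r (by simp) hev.hasLabel d c rid hn (hfresh c rid hmem)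
        exact .inr (by simpa using this)
      · exact .inl (hnC _ hmem)

end Independent

end SecProt

/-! ### The composition theorem -/

theorem mainTheorem2 (M : SecProt.Signature.{u}) [Infinite M.IT]
    (S₁ S₂ : Set (SecProt.Protocol M)) (hS : SecProt.IsProtocolSet (S₁ ∪ S₂))
    (χ : SecProt.Trace M → Prop)
    (hχ : ∀ α ∈ SecProt.Tr (S₁ ∪ S₂), χ α → SecProt.NoSecretInput S₁ S₂ α)
    (hind : SecProt.IndependentIn χ S₁ S₂)
    (f : M.Claim → SecProt.SecurityProperty M)
    (P : SecProt.Protocol M) (hP : P ∈ S₁)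
    (l : M.Label) (r : M.Role) (c : M.Claim) (x : Option (SecProt.RoleTerm M))
    (hl : P.HasEvent (.claim l r c x))
    (hf : SecProt.ProtocolCentric c (f c))
    (hsat : SecProt.Satisfies f S₁ l) :
    SecProt.SatisfiesIn f χ (S₁ ∪ S₂) l := by
  intro α hα hχα inst r' c' x' hmem
  obtain ⟨st, hex⟩ := hα
  have hPS : {P} ⊆ S₁ := Set.singleton_subset_iff.2 hP
  have heq := hS.claim_unique ⟨P, .inl hP, hl⟩ (hex.hasEvent hS hmem) rfl
  obtain ⟨-, rfl, rfl, rfl⟩ := SecProt.Event.claim.inj heq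
  obtain ⟨hsep, hsep'⟩ := hind.encSeparated hS ⟨st, hex⟩ hχα
  obtain ⟨s, h, hrem, hconst⟩ :=
    SecProt.exists_removable hS hind.1 hex (hχ α ⟨st, hex⟩ hχα) hsep hsep'
  obtain ⟨a₀⟩ : Nonempty M.IT := inferInstance
  have hα' := hrem.restrictTrace_mem a₀ hex
  have hmem' := SecProt.mem_restrictTrace (S := S₁) (s := s)
    ⟨P, hP, _, hl, rfl⟩ hmem
  -- Renaming does not change `ρ`, so the alternative of an untrusted agent carries over as it is.
  refine (hsat _ hα' trivial _ _ _ _ hmem').imp_left fun hfc => ?_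
  refine (hf (S₁ ∪ S₂) S₁ hS (hS.mono Set.subset_union_left) P (.inl hP) hP l r' x' hl s α ⟨st, hex⟩
    _ hα' inst (fun ty hty => hconst inst _ ty hmem (hty.mono hPS)) ⟨fun e he ty hty => ?_, ?_⟩).2 hfc
  · exact hconst e.1 e.2 ty (List.mem_filter.1 he).1 (hty.mono hPS)
  · exact SecProt.proj_restrictTrace hP s α
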